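/- Let $d\ge 1$ and $r\ge 3$ be integers, let $\mathbb T_r=(\mathbb Z/r\mathbb Z)^d$ be the discrete torus with its nearest-neighbour edges (each unordered pair $\{x,y\}$ of points differing by $\pm$ a unit vector is one edge), and let $\beta>0$. The Ising expectation on $\mathbb T_r$ is $$\langle F\rangle_\beta=\frac{\sum_\sigma F(\sigma)e^{-\beta H(\sigma)}}{\sum_\sigma e^{-\beta H(\sigma)}},\qquad H(\sigma)=-\sum_{\{x,y\}\text{ an edge}}\sigma_x\sigma_y,$$ with sums over all $\sigma:\mathbb T_r\to\{-1,+1\}$. Put $\chi(\beta)=\sum_{x\in\mathbb T_r}\langle\sigma_0\sigma_x\rangle_\beta$, $\mathsf B(\beta)=\sum_{x\in\mathbb T_r}\langle\sigma_0\sigma_x\rangle_\beta^2$ and $$U_{4,\beta}(0,x,y,z)=\langle\sigma_0\sigma_x\sigma_y\sigma_z\rangle_\beta-\langle\sigma_0\sigma_x\rangle_\beta\langle\sigma_y\sigma_z\rangle_\beta-\langle\sigma_0\sigma_y\rangle_\beta\langle\sigma_x\sigma_z\rangle_\beta-\langle\sigma_0\sigma_z\rangle_\beta\langle\sigma_x\sigma_y\rangle_\beta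 .$$ Then $\chi$ is differentiable at $\beta$ and $$\sum_{x,y,z\in\mathbb T_r}|U_{4,\beta}(0,x,y,z)|\ \ge\ \frac1{128d^2}\min\Big\{\beta\,\chi(\beta)^2\,\frac{\partial\chi}{\partial\beta}(\beta),\ \frac1{\mathsf B(\beta)}\Big(\frac{\partial\chi}{\partial\beta}(\beta)\Big)^2\Big\}.$$ -/

import Mathlib

/-- A spin configuration on a vertex set `V`: each spin is `+1` or `-1`. -/
abbrev SpinConfig (V : Type) : Type := V → ℤˣ

namespace Ising

/-- The spin at `x`, as a real number (`1` or `-1`). -/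
def spin {V : Type} (σ : SpinConfig V) (x : V) : ℝ := ((σ x : ℤ) : ℝ)

variable {V : Type} [Fintype V] [DecidableEq V] (G : SimpleGraph V) [DecidableRel G.Adj]

/-- The Hamiltonian `H(σ) = - ∑_{xy ∈ E} σ_x σ_y`; each unordered edge is counted once. -/
def hamiltonian (σ : SpinConfig V) : ℝ :=
  -∑ e ∈ G.edgeFinset, (e.map (spin σ)).mul

/-- The partition function `Z_β = ∑_σ exp(-β H(σ))`. -/
noncomputable def partitionFunction (β : ℝ) : ℝ :=
  ∑ σ : SpinConfig V, Real.exp (-β * hamiltonian G σ)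

/-- The Ising expectation `⟨F⟩_β` on the finite graph `G` at inverse temperature `β`. -/
noncomputable def expectation (β : ℝ) (F : SpinConfig V → ℝ) : ℝ :=
  (1 / partitionFunction G β) * ∑ σ : SpinConfig V, F σ * Real.exp (-β * hamiltonian G σ)

end Ising

/-- The discrete torus `(ℤ/rℤ)^d`. -/
abbrev Torus (d r : ℕ) : Type := Fin d → ZMod r

/-- The nearest-neighbour graph on the discrete torus: distinct `x`, `y` are adjacent when
they differ by plus or minus a unit vector. -/
def torusGraph (d r : ℕ) : SimpleGraph (Torus d r) :=
  SimpleGraph.fromRel fun x y => ∃ i : Fin d, y = x + Pi.single i 1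

instance torusGraphDecidableAdj (d r : ℕ) : DecidableRel (torusGraph d r).Adj := fun x y =>
  inferInstanceAs (Decidable (x ≠ y ∧
    ((∃ i : Fin d, y = x + Pi.single i 1) ∨ (∃ i : Fin d, x = y + Pi.single i 1))))

namespace TorusIsing

open Ising

variable (d r : ℕ) [NeZero r] (β : ℝ)

/-- The torus two-point function `⟨σ_x σ_y⟩_β`. -/
noncomputable def twoPoint (x y : Torus d r) : ℝ :=
  expectation (torusGraph d r) β fun σ => spin σ x * spin σ y

/-- The torus four-point function `⟨σ_w σ_x σ_y σ_z⟩_β`. -/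
noncomputable def fourPoint (w x y z : Torus d r) : ℝ :=
  expectation (torusGraph d r) β fun σ => spin σ w * spin σ x * spin σ y * spin σ z

/-- The torus susceptibility `χ(β) = ∑_x ⟨σ_0 σ_x⟩_β`. -/
noncomputable def susceptibility : ℝ :=
  ∑ x : Torus d r, twoPoint d r β 0 x

/-- The torus bubble diagram `B(β) = ∑_x ⟨σ_0 σ_x⟩_β ^ 2`. -/
noncomputable def bubble : ℝ :=
  ∑ x : Torus d r, twoPoint d r β 0 x ^ 2

/-- The torus Ursell function `U₄(w, x, y, z)`. -/
noncomputable def ursell4 (w x y z : Torus d r) : ℝ :=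
  fourPoint d r β w x y z
    - twoPoint d r β w x * twoPoint d r β y z
    - twoPoint d r β w y * twoPoint d r β x z
    - twoPoint d r β w z * twoPoint d r β x y

end TorusIsing

/-!
Take two independent copies of the model and expand the product of their Boltzmann weights, edge
by edge, over edge sets `ω`. An edge can be in `ω` only if the two copies agree or disagree at both
of its ends alike, so sources may be moved between the copies cluster by cluster: this is the
switching lemma. It yields Griffiths' inequalities, the identity `U₄ = -2 · (weight of the event
that the four sources share a cluster)` and the tree bound for clusters through prescribed points.

Summing over the cluster `K` of `0` and `x`, the weight of a common cluster becomes the deficit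
`⟨σ_y σ_z⟩ - ⟨σ_y σ_z⟩_{off K}` caused by deleting the edges at `K`. By monotonicity it suffices to
lower these couplings by a fraction `t ∈ [0, 1]` only, and a second-order expansion in `t` bounds
the deficit from below. After summation over `x`, `y`, `z` the first-order term is
`t β χ² ∂χ/∂β`. The remainder consists of third cumulants, which are at most sums of products of
three two-point functions; together with the tree bound they contribute at most a multiple of
`t² d² β² χ⁴ B`. The minimum in the theorem comes from the optimal `t`.
-/

open Finset

namespace Ising

section Spins

variable {V : Type} {ι : Type*}

lemma spin_eq_one_or (σ : SpinConfig V) (x : V) : spin σ x = 1 ∨ spin σ x = -1 := by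
  rcases Int.units_eq_one_or (σ x) with h | h <;> simp [spin, h]

lemma spin_mul (σ θ : SpinConfig V) (x : V) : spin (σ * θ) x = spin σ x * spin θ x := by
  simp [spin]

lemma spin_neg (σ : SpinConfig V) (x : V) : spin (-σ) x = -spin σ x := by
  simp [spin]

lemma spin_mul_self (σ : SpinConfig V) (x : V) : spin σ x * spin σ x = 1 := by
  rcases spin_eq_one_or σ x with h | h <;> simp [h]

/-- The product of the spins at the sites of a list (the sources of a correlation), counted with
multiplicity. -/
def spinProd (l : List V) (σ : SpinConfig V) : ℝ := (l.map (spin σ)).prod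

@[simp] lemma spinProd_nil (σ : SpinConfig V) : spinProd [] σ = 1 := rfl

@[simp] lemma spinProd_cons (x : V) (l : List V) (σ : SpinConfig V) :
    spinProd (x :: l) σ = spin σ x * spinProd l σ := by
  simp [spinProd]

lemma spinProd_append (l l' : List V) (σ : SpinConfig V) :
    spinProd (l ++ l') σ = spinProd l σ * spinProd l' σ := by
  simp [spinProd]

lemma spinProd_mul (l : List V) (σ θ : SpinConfig V) :
    spinProd l (σ * θ) = spinProd l σ * spinProd l θ := by
  simp only [spinProd, ← List.prod_map_mul, ← spin_mul]

lemma spinProd_neg (l : List V) (σ : SpinConfig V) :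
    spinProd l (-σ) = (-1) ^ l.length * spinProd l σ := by
  induction l with
  | nil => simp
  | cons x l ih => simp only [spinProd_cons, spin_neg, ih, List.length_cons, pow_succ]; ring

lemma spinProd_eq_one_or (l : List V) (σ : SpinConfig V) :
    spinProd l σ = 1 ∨ spinProd l σ = -1 := by
  induction l with
  | nil => simp
  | cons x l ih => rcases ih with h | h <;> rcases spin_eq_one_or σ x with h' | h' <;> simp [h, h']

lemma spinProd_congr {l : List V} {σ τ : SpinConfig V} (h : ∀ x ∈ l, σ x = τ x) :
    spinProd l σ = spinProd l τ :=
  congrArg List.prod <| List.map_congr_left fun x hx => by rw [spin, spin, h x hx]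

lemma spinProd_filter_mul_filter_not (p : V → Prop) [DecidablePred p] (l : List V)
    (σ : SpinConfig V) :
    spinProd (l.filter p) σ * spinProd (l.filter (¬ p ·)) σ = spinProd l σ := by
  induction l with
  | nil => simp
  | cons x l ih => by_cases h : p x <;> simp [h, ← ih] <;> ring

/-- The bond variable `σ_x σ_y` of an edge `e = xy` of the multigraph `E`, in which each index `e`
stands for one edge between the ends `(E e).1` and `(E e).2`. -/
def bond (E : ι → V × V) (e : ι) (σ : SpinConfig V) : ℝ := spin σ (E e).1 * spin σ (E e).2

variable (E : ι → V × V) (e : ι)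

lemma bond_eq_one_or (σ : SpinConfig V) : bond E e σ = 1 ∨ bond E e σ = -1 := by
  rcases spin_eq_one_or σ (E e).1 with h | h <;> rcases spin_eq_one_or σ (E e).2 with h' | h' <;>
    simp [bond, h, h']

lemma bond_mul (σ θ : SpinConfig V) : bond E e (σ * θ) = bond E e σ * bond E e θ := by
  simp only [bond, spin_mul]; ring

lemma bond_neg (σ : SpinConfig V) : bond E e (-σ) = bond E e σ := by
  simp only [bond, spin_neg]; ring

variable {E e} in
lemma bond_congr {σ τ : SpinConfig V} (hfst : σ (E e).1 = τ (E e).1)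
    (hsnd : σ (E e).2 = τ (E e).2) : bond E e σ = bond E e τ := by
  simp only [bond, spin, hfst, hsnd]

variable {E e} in
lemma bond_eq_one_iff {θ : SpinConfig V} : bond E e θ = 1 ↔ θ (E e).1 = θ (E e).2 := by
  rcases Int.units_eq_one_or (θ (E e).1) with h | h <;>
    rcases Int.units_eq_one_or (θ (E e).2) with h' | h' <;> simp [bond, spin, h, h'] <;> norm_num

lemma exp_mul_bond (j : ℝ) (σ : SpinConfig V) :
    Real.exp (j * bond E e σ) = Real.cosh j + Real.sinh j * bond E e σ := by
  rcases bond_eq_one_or E e σ with h | h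
  · simp [h, Real.cosh_add_sinh]
  · simp [h, ← sub_eq_add_neg, Real.cosh_sub_sinh]

end Spins

section Correlations

variable {V : Type} {ι : Type*} [Fintype V] [DecidableEq V]

lemma sum_spinProd_nonneg (l : List V) : 0 ≤ ∑ σ : SpinConfig V, spinProd l σ := by
  by_cases h : ∃ θ : SpinConfig V, spinProd l θ = -1
  · obtain ⟨θ, hθ⟩ := h
    have hflip := Equiv.sum_comp (Equiv.mulRight θ) (fun σ : SpinConfig V => spinProd l σ)
    simp only [Equiv.coe_mulRight, spinProd_mul, hθ, ← Finset.sum_mul] at hflip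
    linarith
  · refine sum_nonneg fun σ _ => ?_
    rw [(spinProd_eq_one_or l σ).resolve_right fun hσ => h ⟨σ, hσ⟩]
    exact zero_le_one

lemma sum_spinProd_mul_prod_nonneg (E : ι → V × V) {a b : ι → ℝ} (ha : ∀ e, 0 ≤ a e)
    (hb : ∀ e, 0 ≤ b e) (S : Finset ι) (l : List V) :
    0 ≤ ∑ σ : SpinConfig V, spinProd l σ * ∏ e ∈ S, (a e + b e * bond E e σ) := by
  classical
  induction S using Finset.induction_on generalizing l with
  | empty => simpa using sum_spinProd_nonneg l
  | insert e S he ih =>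
    have hexpand : ∑ σ : SpinConfig V, spinProd l σ * ∏ e ∈ insert e S, (a e + b e * bond E e σ)
        = a e * ∑ σ : SpinConfig V, spinProd l σ * ∏ e ∈ S, (a e + b e * bond E e σ)
          + b e * ∑ σ : SpinConfig V, spinProd ((E e).1 :: (E e).2 :: l) σ *
              ∏ e ∈ S, (a e + b e * bond E e σ) := by
      rw [mul_sum, mul_sum, ← sum_add_distrib]
      refine sum_congr rfl fun σ _ => ?_
      rw [prod_insert he]
      simp only [spinProd_cons, bond]
      ring
    rw [hexpand]
    exact add_nonneg (mul_nonneg (ha e) (ih l)) (mul_nonneg (hb e) (ih _))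

variable [Fintype ι] (E : ι → V × V) (J : ι → ℝ)

/-- The Boltzmann weight of the Ising model on the multigraph `E` with edge-dependent
couplings `J`. -/
noncomputable def weight (σ : SpinConfig V) : ℝ := Real.exp (∑ e, J e * bond E e σ)

/-- The partition function of the Ising model with edge-dependent couplings. -/
noncomputable def weightSum : ℝ := ∑ σ : SpinConfig V, weight E J σ

/-- The correlation `⟨∏_{x ∈ l} σ_x⟩` of the Ising model with edge-dependent couplings. -/
noncomputable def corr (l : List V) : ℝ :=
  (∑ σ : SpinConfig V, spinProd l σ * weight E J σ) / weightSum E J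

lemma weightSum_pos : 0 < weightSum E J :=
  sum_pos (fun _ _ => Real.exp_pos _) univ_nonempty

lemma sum_spinProd_mul_weight (l : List V) :
    ∑ σ : SpinConfig V, spinProd l σ * weight E J σ = corr E J l * weightSum E J := by
  rw [corr, div_mul_cancel₀ _ (weightSum_pos E J).ne']

lemma corr_congr {l l' : List V} (h : ∀ σ, spinProd l σ = spinProd l' σ) :
    corr E J l = corr E J l' := by
  simp only [corr, h]

@[simp] lemma corr_nil : corr E J [] = 1 := by
  simp only [corr, spinProd_nil, one_mul]
  exact div_self (weightSum_pos E J).ne'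

@[simp] lemma corr_pair_self (x : V) : corr E J [x, x] = 1 := by
  rw [← corr_nil E J]
  exact corr_congr E J fun σ => by simp [spin_mul_self]

lemma corr_pair_comm (x y : V) : corr E J [x, y] = corr E J [y, x] :=
  corr_congr E J fun σ => by simp [mul_comm]

variable {J}

/-- Griffiths' first inequality. -/
theorem corr_nonneg (hJ : ∀ e, 0 ≤ J e) (l : List V) : 0 ≤ corr E J l := by
  refine div_nonneg ?_ (weightSum_pos E J).le
  simp only [weight, Real.exp_sum, exp_mul_bond]
  exact sum_spinProd_mul_prod_nonneg E (fun e => (Real.cosh_pos _).le)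
    (fun e => Real.sinh_nonneg_iff.2 (hJ e)) _ l

end Correlations

section EdgeSets

variable {V : Type} {ι : Type*} [DecidableEq V] [Fintype ι]

/-- The edges with both ends in `K`. -/
def innerEdges (E : ι → V × V) (K : Finset V) : Finset ι := {e | (E e).1 ∈ K ∧ (E e).2 ∈ K}

/-- The edges with no end in `K`. -/
def outerEdges (E : ι → V × V) (K : Finset V) : Finset ι := {e | (E e).1 ∉ K ∧ (E e).2 ∉ K}

lemma disjoint_innerEdges_outerEdges (E : ι → V × V) (K : Finset V) :
    Disjoint (innerEdges E K) (outerEdges E K) :=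
  disjoint_filter.2 fun _ _ hin hout => hout.1 hin.1

end EdgeSets

section Clusters

variable {V : Type} {ι : Type*} [Fintype V] (E : ι → V × V)

open Classical in
/-- The cluster of `x`: the connected component of `x` in the multigraph with edge set `ω`. -/
noncomputable def cluster (ω : Finset ι) (x : V) : Finset V :=
  {y | Relation.EqvGen (fun u v => ∃ e ∈ ω, E e = (u, v)) x y}

lemma mem_cluster_self (ω : Finset ι) (x : V) : x ∈ cluster E ω x := by
  simpa [cluster] using .refl x

variable {E} {ω η : Finset ι} {x y : V}

lemma cluster_eq_of_mem (h : y ∈ cluster E ω x) : cluster E ω y = cluster E ω x := by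
  simp only [cluster, mem_filter_univ] at h
  ext z
  simp only [cluster, mem_filter_univ]
  exact ⟨h.trans _ _ _, (h.symm _ _).trans _ _ _⟩

lemma fst_mem_cluster_iff {e : ι} (he : e ∈ ω) :
    (E e).1 ∈ cluster E ω x ↔ (E e).2 ∈ cluster E ω x := by
  have hlink : Relation.EqvGen (fun u v => ∃ e ∈ ω, E e = (u, v)) (E e).1 (E e).2 :=
    .rel _ _ ⟨e, he, rfl⟩
  simp only [cluster, mem_filter_univ]
  exact ⟨fun h => h.trans _ _ _ hlink, fun h => h.trans _ _ _ (hlink.symm _ _)⟩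

lemma eq_of_mem_cluster {α : Type*} {f : V → α} (hf : ∀ e ∈ ω, f (E e).1 = f (E e).2)
    (hy : y ∈ cluster E ω x) : f y = f x := by
  simp only [cluster, mem_filter_univ] at hy
  induction hy with
  | rel u v h => obtain ⟨e, he, heq⟩ := h; simpa [heq] using (hf e he).symm
  | refl => rfl
  | symm u v _ ih => exact ih.symm
  | trans u v w _ _ ih ih' => exact ih'.trans ih

lemma cluster_subset {S : Finset V} (hx : x ∈ S) (hS : ∀ e ∈ ω, (E e).1 ∈ S ↔ (E e).2 ∈ S) :
    cluster E ω x ⊆ S := fun _ hy =>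
  (eq_of_mem_cluster (f := (· ∈ S)) (fun e he => propext (hS e he)) hy).mpr hx

lemma cluster_mono (h : ω ⊆ η) : cluster E ω x ⊆ cluster E η x :=
  cluster_subset (mem_cluster_self E η x) fun _ he => fst_mem_cluster_iff (h he)

variable [DecidableEq V] [Fintype ι]

open Classical in
/-- The edge sets inside `K` that connect all of `K`. -/
noncomputable def connecting (E : ι → V × V) (K : Finset V) : Finset (Finset ι) :=
  {ω ∈ (innerEdges E K).powerset | ∀ x ∈ K, cluster E ω x = K}

lemma mem_connecting_iff {K : Finset V} {o : V} (ho : o ∈ K) :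
    ω ∈ connecting E K ↔ ω ⊆ innerEdges E K ∧ cluster E ω o = K := by
  simp only [connecting, mem_filter, mem_powerset]
  refine and_congr_right fun _ => ⟨fun h => h o ho, fun h x hx => ?_⟩
  rw [cluster_eq_of_mem (h.symm ▸ hx), h]

variable {K : Finset V}

section DecidableEdges

variable [DecidableEq ι]

lemma inter_innerEdges_union_inter_outerEdges (h : cluster E ω x = K) :
    ω ∩ innerEdges E K ∪ ω ∩ outerEdges E K = ω := by
  rw [← inter_union_distrib_left, inter_eq_left]
  intro e he
  have hclosed := fst_mem_cluster_iff (E := E) (x := x) he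
  rw [h] at hclosed
  simp only [innerEdges, outerEdges, mem_union, mem_filter_univ]
  tauto

lemma cluster_inter_innerEdges (h : cluster E ω x = K) :
    cluster E (ω ∩ innerEdges E K) x = K := by
  have hsub : cluster E (ω ∩ innerEdges E K) x ⊆ K := h ▸ cluster_mono inter_subset_left
  refine hsub.antisymm (h.symm.subset.trans <| cluster_subset (mem_cluster_self _ _ _) ?_)
  intro e he
  by_cases hin : e ∈ innerEdges E K
  · exact fst_mem_cluster_iff (mem_inter.2 ⟨he, hin⟩)
  · have hclosed := fst_mem_cluster_iff (E := E) (x := x) he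
    simp only [innerEdges, mem_filter_univ] at hin
    rw [h] at hclosed
    exact iff_of_false (fun h1 => hin ⟨hsub h1, hclosed.1 (hsub h1)⟩)
      (fun h2 => hin ⟨hclosed.2 (hsub h2), hsub h2⟩)

lemma cluster_union_of_subset_outerEdges (h : cluster E ω x = K) (hη : η ⊆ outerEdges E K) :
    cluster E (ω ∪ η) x = K := by
  subst h
  refine (cluster_subset (mem_cluster_self _ _ _) fun e he => ?_).antisymm
    (cluster_mono subset_union_left)
  rcases mem_union.1 he with he | he
  · exact fst_mem_cluster_iff he
  · obtain ⟨h1, h2⟩ := mem_filter_univ _ |>.1 (hη he)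
    exact iff_of_false h1 h2

end DecidableEdges

lemma sum_cluster_eq_prod (f : ι → ℝ) {o : V} (ho : o ∈ K) :
    ∑ ω : Finset ι with cluster E ω o = K, ∏ e ∈ ω, f e =
      (∑ ω ∈ connecting E K, ∏ e ∈ ω, f e) * ∏ e ∈ outerEdges E K, (1 + f e) := by
  classical
  have hdisj := disjoint_innerEdges_outerEdges E K
  rw [prod_one_add, sum_mul_sum, ← sum_product']
  refine sum_bij' (fun ω _ => (ω ∩ innerEdges E K, ω ∩ outerEdges E K)) (fun q _ => q.1 ∪ q.2)
    ?_ ?_ ?_ ?_ ?_ <;>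
    simp only [mem_filter_univ, mem_product, mem_connecting_iff ho, mem_powerset]
  · exact fun ω hω => ⟨⟨inter_subset_right, cluster_inter_innerEdges hω⟩, inter_subset_right⟩
  · exact fun q hq => cluster_union_of_subset_outerEdges hq.1.2 hq.2
  · exact fun ω hω => inter_innerEdges_union_inter_outerEdges hω
  · rintro ⟨ω, η⟩ ⟨⟨hω, -⟩, hη⟩
    simp only [union_inter_distrib_right, inter_eq_left.2 hω, inter_eq_left.2 hη,
      disjoint_iff_inter_eq_empty.1 (hdisj.mono_left hω),
      disjoint_iff_inter_eq_empty.1 (hdisj.symm.mono_left hη),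
      union_empty, empty_union]
  · intro ω hω
    rw [← prod_union (hdisj.mono inter_subset_right inter_subset_right),
      inter_innerEdges_union_inter_outerEdges hω]

end Clusters

section Cut

variable {V : Type} {ι : Type*} [DecidableEq V]

/-- The couplings after deletion of all edges touching `K`. -/
def cut (E : ι → V × V) (J : ι → ℝ) (K : Finset V) (e : ι) : ℝ :=
  if (E e).1 ∉ K ∧ (E e).2 ∉ K then J e else 0

variable (E : ι → V × V) {J : ι → ℝ} (hJ : ∀ e, 0 ≤ J e)
include hJ

lemma cut_nonneg (K : Finset V) (e : ι) : 0 ≤ cut E J K e := by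
  unfold cut; split_ifs <;> simp [hJ]

lemma cut_le (K : Finset V) (e : ι) : cut E J K e ≤ J e := by
  unfold cut; split_ifs <;> simp [hJ]

end Cut

section Mayer

variable {V : Type} {ι : Type*} (E : ι → V × V) (J : ι → ℝ)

/-- The Mayer factor of an edge in the doubled system: its joint Boltzmann factor minus one. -/
noncomputable def mayer (σ τ : SpinConfig V) (e : ι) : ℝ :=
  Real.exp (J e * (bond E e σ + bond E e τ)) - 1

variable {E} in
lemma mayer_congr {σ τ σ' τ' : SpinConfig V} {e : ι}
    (hσ : σ (E e).1 = σ' (E e).1 ∧ σ (E e).2 = σ' (E e).2)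
    (hτ : τ (E e).1 = τ' (E e).1 ∧ τ (E e).2 = τ' (E e).2) :
    mayer E J σ τ e = mayer E J σ' τ' e := by
  simp only [mayer, bond_congr hσ.1 hσ.2, bond_congr hτ.1 hτ.2]

-- An edge on which the two spin systems disagree has `bond E e σ + bond E e (σ * θ) = 0`.
lemma prod_mayer_mul (ω : Finset ι) (σ θ : SpinConfig V) [Decidable (∀ e ∈ ω, bond E e θ = 1)] :
    ∏ e ∈ ω, mayer E J σ (σ * θ) e =
      if ∀ e ∈ ω, bond E e θ = 1 then ∏ e ∈ ω, (Real.exp (2 * J e * bond E e σ) - 1) else 0 := by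
  split_ifs with h
  · refine prod_congr rfl fun e he => ?_
    rw [mayer, bond_mul, h e he]
    ring_nf
  · push Not at h
    obtain ⟨e, he, hne⟩ := h
    refine prod_eq_zero he ?_
    rw [mayer, bond_mul, (bond_eq_one_or E e θ).resolve_left hne]
    simp

variable [Fintype ι]

lemma weight_mul_weight (σ τ : SpinConfig V) :
    weight E J σ * weight E J τ = ∏ e, (1 + mayer E J σ τ e) := by
  simp only [weight, mayer, add_sub_cancel, mul_add, Real.exp_add, Real.exp_sum,
    prod_mul_distrib]

lemma weight_cut_mul_weight_cut [DecidableEq V] (K : Finset V) (σ τ : SpinConfig V) :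
    weight E (cut E J K) σ * weight E (cut E J K) τ =
      ∏ e ∈ outerEdges E K, (1 + mayer E J σ τ e) := by
  rw [weight_mul_weight, outerEdges, prod_filter]
  refine prod_congr rfl fun e _ => ?_
  by_cases he : (E e).1 ∉ K ∧ (E e).2 ∉ K <;> simp [mayer, cut, he]

lemma weight_mul_weight_eq_sum_clusters [Fintype V] [DecidableEq V] (o : V)
    (σ τ : SpinConfig V) :
    weight E J σ * weight E J τ = ∑ K : Finset V with o ∈ K,
      (∑ ω ∈ connecting E K, ∏ e ∈ ω, mayer E J σ τ e) *
        ∏ e ∈ outerEdges E K, (1 + mayer E J σ τ e) := by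
  classical
  rw [weight_mul_weight, prod_one_add, powerset_univ,
    ← sum_fiberwise_of_maps_to (g := fun ω => cluster E ω o) (t := {K : Finset V | o ∈ K})
      fun ω _ => by simp [mem_cluster_self]]
  exact sum_congr rfl fun K hK => sum_cluster_eq_prod _ ((mem_filter_univ K).1 hK)

end Mayer

section ConstantConfigurations

variable {V : Type} {ι : Type*} [Fintype V] [DecidableEq V]

/-- The configurations that are constant on `K`. -/
def constOn (K : Finset V) : Finset (SpinConfig V) := {θ | ∀ x ∈ K, ∀ y ∈ K, θ x = θ y}

variable {K : Finset V} {o : V} (ho : o ∈ K)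
include ho

lemma mem_constOn_iff {θ : SpinConfig V} : θ ∈ constOn K ↔ ∀ x ∈ K, θ x = θ o := by
  simp only [constOn, mem_filter_univ]
  exact ⟨fun h x hx => h x hx o ho, fun h x hx y hy => by rw [h x hx, h y hy]⟩

lemma forall_bond_eq_one_iff [Fintype ι] {E : ι → V × V} {ω : Finset ι}
    (hω : ω ∈ connecting E K) (θ : SpinConfig V) :
    (∀ e ∈ ω, bond E e θ = 1) ↔ θ ∈ constOn K := by
  obtain ⟨hin, hcluster⟩ := (mem_connecting_iff ho).1 hω
  simp only [bond_eq_one_iff, mem_constOn_iff ho]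
  refine ⟨fun h x hx => eq_of_mem_cluster h (hcluster.symm ▸ hx), fun h e he => ?_⟩
  obtain ⟨hfst, hsnd⟩ := (mem_filter_univ e).1 (hin he)
  rw [h _ hfst, h _ hsnd]

lemma spinProd_of_mem_constOn {θ : SpinConfig V} (hθ : θ ∈ constOn K) {l : List V}
    (hl : ∀ x ∈ l, x ∈ K) : spinProd l θ = spin θ o ^ l.length := by
  have hspin : ∀ x ∈ l, spin θ x = spin θ o := fun x hx => by
    rw [spin, spin, (mem_constOn_iff ho).1 hθ x (hl x hx)]
  rw [spinProd, List.map_congr_left hspin, List.map_const', List.prod_replicate]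

lemma sum_constOn_spinProd {l : List V} (hl : ∀ x ∈ l, x ∈ K) :
    ∑ θ ∈ constOn K, spinProd l θ = if Even l.length then (#(constOn K) : ℝ) else 0 := by
  split_ifs with h
  · rw [cast_card]
    refine sum_congr rfl fun θ hθ => ?_
    rw [spinProd_of_mem_constOn ho hθ hl]
    rcases spin_eq_one_or θ o with h' | h' <;> simp [h', h]
  · have hneg : ∑ θ ∈ constOn K, spinProd l θ = ∑ θ ∈ constOn K, spinProd l (-θ) := by
      refine sum_nbij' (fun θ => -θ) (fun θ => -θ) ?_ ?_ ?_ ?_ ?_ <;> simp [constOn]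
    simp only [spinProd_neg, (Nat.not_even_iff_odd.1 h).neg_one_pow, neg_one_mul,
      sum_neg_distrib] at hneg
    linarith

end ConstantConfigurations

section ClusterWeight

variable {V : Type} {ι : Type*} [Fintype V] [DecidableEq V] [Fintype ι]

/-- The total weight, with sources `l`, of the edge sets connecting `K` in the doubled system
after the two spin systems have been identified on `K`. -/
noncomputable def connWeight (E : ι → V × V) (J : ι → ℝ) (K : Finset V) (l : List V) : ℝ :=
  ∑ ω ∈ connecting E K, ∑ σ : SpinConfig V,
    spinProd l σ * ∏ e ∈ ω, (Real.exp (2 * J e * bond E e σ) - 1)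

lemma connWeight_nonneg (E : ι → V × V) {J : ι → ℝ} (hJ : ∀ e, 0 ≤ J e) (K : Finset V)
    (l : List V) : 0 ≤ connWeight E J K l := by
  refine sum_nonneg fun ω _ => ?_
  simp only [exp_mul_bond, add_sub_right_comm]
  exact sum_spinProd_mul_prod_nonneg E (fun e => sub_nonneg.2 (Real.one_le_cosh _))
    (fun e => Real.sinh_nonneg_iff.2 (mul_nonneg zero_le_two (hJ e))) _ _

lemma connWeight_of_odd (E : ι → V × V) (J : ι → ℝ) (K : Finset V) {l : List V}
    (hl : Odd l.length) : connWeight E J K l = 0 := by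
  refine sum_eq_zero fun ω _ => ?_
  have hneg := Equiv.sum_comp (Equiv.neg (SpinConfig V)) (fun σ : SpinConfig V =>
    spinProd l σ * ∏ e ∈ ω, (Real.exp (2 * J e * bond E e σ) - 1))
  simp only [Equiv.neg_apply, spinProd_neg, bond_neg, hl.neg_one_pow, neg_mul, one_mul,
    sum_neg_distrib] at hneg
  linarith

/-- The normalised weight, with sources `l`, of the event that `K` is the cluster of a given point
of `K` in the doubled system. -/
noncomputable def clusterWeight (E : ι → V × V) (J : ι → ℝ) (K : Finset V) (l : List V) : ℝ :=
  #(constOn K) * connWeight E J K l * weightSum E (cut E J K) ^ 2 /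
    (Fintype.card (SpinConfig V × SpinConfig V) * weightSum E J ^ 2)

lemma clusterWeight_nonneg (E : ι → V × V) {J : ι → ℝ} (hJ : ∀ e, 0 ≤ J e) (K : Finset V)
    (l : List V) : 0 ≤ clusterWeight E J K l := by
  have := connWeight_nonneg E hJ K l
  unfold clusterWeight
  positivity

variable (E : ι → V × V) (J : ι → ℝ) (K : Finset V)

lemma clusterWeight_of_odd {l : List V} (hl : Odd l.length) : clusterWeight E J K l = 0 := by
  simp [clusterWeight, connWeight_of_odd E J K hl]

lemma clusterWeight_congr {l l' : List V} (h : ∀ σ, spinProd l σ = spinProd l' σ) :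
    clusterWeight E J K l = clusterWeight E J K l' := by
  simp only [clusterWeight, connWeight, h]

end ClusterWeight

section SwitchingLemma

lemma sum_mul_sum_of_swap {α : Type*} [Fintype α] {m : α → α → α}
    (hm : ∀ a b, m (m a b) (m b a) = a) {F G : α → ℝ} (hF : ∀ a b, F (m a b) = F a)
    (hG : ∀ a b, G (m a b) = G b) :
    (∑ a, F a) * ∑ a, G a = Fintype.card α * ∑ a, F a * G a := by
  have hinv : Function.Involutive fun q : α × α => (m q.1 q.2, m q.2 q.1) :=
    fun q => by simp [hm]
  calc (∑ a, F a) * ∑ a, G a = ∑ q : α × α, F q.1 * G q.2 := by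
        rw [sum_mul_sum, Fintype.sum_prod_type]
    _ = ∑ q : α × α, F (m q.1 q.2) * G (m q.1 q.2) :=
        sum_congr rfl fun q _ => by rw [hF, hG]
    _ = ∑ q : α × α, F q.1 * G q.1 :=
        Equiv.sum_comp hinv.toPerm fun q : α × α => F q.1 * G q.1
    _ = Fintype.card α * ∑ a, F a * G a := by
        simp [Fintype.sum_prod_type, ← mul_sum]

variable {V : Type} {ι : Type*} [Fintype V] [DecidableEq V] [Fintype ι]
  (E : ι → V × V) (J : ι → ℝ) {K : Finset V}

variable (K) in
/-- The contribution to the doubled system of the edge sets connecting `K`, with sources `A` in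
the first and `B` in the second spin system. -/
noncomputable def insideFactor (A B : List V) (p : SpinConfig V × SpinConfig V) : ℝ :=
  spinProd A p.1 * spinProd B p.2 * ∑ ω ∈ connecting E K, ∏ e ∈ ω, mayer E J p.1 p.2 e

variable (K) in
/-- The contribution to the doubled system of the edges off `K`, with sources `A` in the first
and `B` in the second spin system. -/
noncomputable def outsideFactor (A B : List V) (p : SpinConfig V × SpinConfig V) : ℝ :=
  spinProd A p.1 * spinProd B p.2 * ∏ e ∈ outerEdges E K, (1 + mayer E J p.1 p.2 e)

lemma insideFactor_congr {A B : List V} (hA : ∀ x ∈ A, x ∈ K) (hB : ∀ x ∈ B, x ∈ K)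
    {p q : SpinConfig V × SpinConfig V} (hfst : ∀ x ∈ K, p.1 x = q.1 x)
    (hsnd : ∀ x ∈ K, p.2 x = q.2 x) : insideFactor E J K A B p = insideFactor E J K A B q := by
  rw [insideFactor, insideFactor, spinProd_congr fun x hx => hfst x (hA x hx),
    spinProd_congr fun x hx => hsnd x (hB x hx)]
  congr 1
  refine sum_congr rfl fun ω hω => prod_congr rfl fun e he => ?_
  obtain ⟨h1, h2⟩ := (mem_filter_univ e).1 (mem_powerset.1 (mem_filter.1 hω).1 he)
  exact mayer_congr J ⟨hfst _ h1, hfst _ h2⟩ ⟨hsnd _ h1, hsnd _ h2⟩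

omit [Fintype V] in
lemma outsideFactor_congr {A B : List V} (hA : ∀ x ∈ A, x ∉ K) (hB : ∀ x ∈ B, x ∉ K)
    {p q : SpinConfig V × SpinConfig V} (hfst : ∀ x ∉ K, p.1 x = q.1 x)
    (hsnd : ∀ x ∉ K, p.2 x = q.2 x) : outsideFactor E J K A B p = outsideFactor E J K A B q := by
  rw [outsideFactor, outsideFactor, spinProd_congr fun x hx => hfst x (hA x hx),
    spinProd_congr fun x hx => hsnd x (hB x hx)]
  congr 1
  refine prod_congr rfl fun e he => ?_
  obtain ⟨h1, h2⟩ := (mem_filter_univ e).1 he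
  rw [mayer_congr J ⟨hfst _ h1, hfst _ h2⟩ ⟨hsnd _ h1, hsnd _ h2⟩]

lemma insideFactor_mul {o : V} (ho : o ∈ K) (A B : List V) (σ θ : SpinConfig V) :
    insideFactor E J K A B (σ, σ * θ) = if θ ∈ constOn K then
      spinProd B θ * ∑ ω ∈ connecting E K, spinProd (A ++ B) σ *
        ∏ e ∈ ω, (Real.exp (2 * J e * bond E e σ) - 1) else 0 := by
  classical
  have hprod : ∀ ω ∈ connecting E K, ∏ e ∈ ω, mayer E J σ (σ * θ) e = if θ ∈ constOn K then
      ∏ e ∈ ω, (Real.exp (2 * J e * bond E e σ) - 1) else 0 := fun ω hω => by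
    rw [prod_mayer_mul]
    exact if_congr (forall_bond_eq_one_iff ho hω θ) rfl rfl
  rw [insideFactor, sum_congr rfl hprod, spinProd_mul, spinProd_append]
  split_ifs
  · rw [← mul_sum]; ring
  · simp

lemma sum_insideFactor {o : V} (ho : o ∈ K) (A : List V) {B : List V} (hB : ∀ x ∈ B, x ∈ K) :
    ∑ p, insideFactor E J K A B p =
      (if Even B.length then (#(constOn K) : ℝ) else 0) * connWeight E J K (A ++ B) := by
  have hrelative : ∀ σ, ∑ τ, insideFactor E J K A B (σ, τ) =
      ∑ θ ∈ constOn K, spinProd B θ * ∑ ω ∈ connecting E K, spinProd (A ++ B) σ *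
        ∏ e ∈ ω, (Real.exp (2 * J e * bond E e σ) - 1) := fun σ => by
    rw [← Equiv.sum_comp (Equiv.mulLeft σ)]
    simp only [Equiv.coe_mulLeft, insideFactor_mul E J ho, sum_ite_mem, univ_inter]
  simp only [Fintype.sum_prod_type, hrelative, ← sum_mul]
  rw [← mul_sum, sum_constOn_spinProd ho hB, connWeight, sum_comm]

lemma sum_outsideFactor (A B : List V) :
    ∑ p, outsideFactor E J K A B p =
      corr E (cut E J K) A * corr E (cut E J K) B * weightSum E (cut E J K) ^ 2 := by
  calc ∑ p, outsideFactor E J K A B p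
      = ∑ σ : SpinConfig V, ∑ τ : SpinConfig V, (spinProd A σ * weight E (cut E J K) σ) *
          (spinProd B τ * weight E (cut E J K) τ) := by
        rw [Fintype.sum_prod_type]
        refine sum_congr rfl fun σ _ => sum_congr rfl fun τ _ => ?_
        rw [outsideFactor, ← weight_cut_mul_weight_cut]
        ring
    _ = _ := by
        rw [← sum_mul_sum, sum_spinProd_mul_weight, sum_spinProd_mul_weight]
        ring

/-- The two factors live on disjoint sets of sites, so the sum of their product factorises. -/
lemma sum_insideFactor_mul_outsideFactor {o : V} (ho : o ∈ K) {A B A' B' : List V}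
    (hA : ∀ x ∈ A, x ∈ K) (hB : ∀ x ∈ B, x ∈ K) (hA' : ∀ x ∈ A', x ∉ K)
    (hB' : ∀ x ∈ B', x ∉ K) :
    ∑ p, insideFactor E J K A B p * outsideFactor E J K A' B' p =
      (if Even B.length then clusterWeight E J K (A ++ B) else 0) *
        corr E (cut E J K) A' * corr E (cut E J K) B' * weightSum E J ^ 2 := by
  have hproduct := sum_mul_sum_of_swap
    (m := fun p q : SpinConfig V × SpinConfig V =>
      (K.piecewise p.1 q.1, K.piecewise p.2 q.2))
    (fun p q => by ext x <;> by_cases hx : x ∈ K <;> simp [hx])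
    (fun p q => insideFactor_congr E J hA hB (fun x hx => by simp [hx]) fun x hx => by simp [hx])
    (fun p q => outsideFactor_congr E J hA' hB' (fun x hx => by simp [hx])
      fun x hx => by simp [hx])
  rw [sum_insideFactor E J ho A hB, sum_outsideFactor] at hproduct
  have hcard : (Fintype.card (SpinConfig V × SpinConfig V) : ℝ) ≠ 0 := by
    exact_mod_cast Fintype.card_ne_zero
  have hpos := weightSum_pos E J
  rw [← mul_right_inj' hcard, ← hproduct]
  unfold clusterWeight
  split_ifs
  · field_simp
  · simp

/-- The cluster form of the switching lemma: the sources meeting the cluster `K` of `o` may be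
moved to one copy, provided the second copy has an even number of sources in `K`. -/
theorem corr_mul_corr (o : V) (A B : List V) :
    corr E J A * corr E J B = ∑ K : Finset V with o ∈ K,
      (if Even (B.filter (· ∈ K)).length then clusterWeight E J K ((A ++ B).filter (· ∈ K))
        else 0) *
      corr E (cut E J K) (A.filter (· ∉ K)) * corr E (cut E J K) (B.filter (· ∉ K)) := by
  have hfactor : ∀ (K : Finset V) (p : SpinConfig V × SpinConfig V),
      spinProd A p.1 * spinProd B p.2 * ((∑ ω ∈ connecting E K, ∏ e ∈ ω, mayer E J p.1 p.2 e) *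
        ∏ e ∈ outerEdges E K, (1 + mayer E J p.1 p.2 e)) =
      insideFactor E J K (A.filter (· ∈ K)) (B.filter (· ∈ K)) p *
        outsideFactor E J K (A.filter (· ∉ K)) (B.filter (· ∉ K)) p := fun K p => by
    rw [insideFactor, outsideFactor, ← spinProd_filter_mul_filter_not (· ∈ K) A,
      ← spinProd_filter_mul_filter_not (· ∈ K) B]
    ring
  have hpos := weightSum_pos E J
  refine mul_right_cancel₀ (pow_ne_zero 2 hpos.ne') ?_
  calc corr E J A * corr E J B * weightSum E J ^ 2
      = ∑ p : SpinConfig V × SpinConfig V,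
          spinProd A p.1 * spinProd B p.2 * (weight E J p.1 * weight E J p.2) := by
        rw [sq, mul_mul_mul_comm, ← sum_spinProd_mul_weight, ← sum_spinProd_mul_weight,
          sum_mul_sum, Fintype.sum_prod_type]
        exact sum_congr rfl fun σ _ => sum_congr rfl fun τ _ => mul_mul_mul_comm _ _ _ _
    _ = ∑ K : Finset V with o ∈ K, ∑ p,
          insideFactor E J K (A.filter (· ∈ K)) (B.filter (· ∈ K)) p *
            outsideFactor E J K (A.filter (· ∉ K)) (B.filter (· ∉ K)) p := by
        simp only [weight_mul_weight_eq_sum_clusters E J o, mul_sum, hfactor]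
        exact sum_comm
    _ = _ := by
        rw [sum_mul]
        refine sum_congr rfl fun K hK => ?_
        rw [sum_insideFactor_mul_outsideFactor E J ((mem_filter_univ K).1 hK), List.filter_append]
        all_goals exact fun x hx => by simpa using (List.mem_filter.1 hx).2

end SwitchingLemma

section ClusterExpansions

variable {V : Type} {ι : Type*} [Fintype V] [DecidableEq V] [Fintype ι]
  (E : ι → V × V) (J : ι → ℝ)

@[simp] lemma clusterWeight_singleton (K : Finset V) (a : V) : clusterWeight E J K [a] = 0 :=
  clusterWeight_of_odd E J K odd_one

@[simp] lemma clusterWeight_triple (K : Finset V) (a b c : V) :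
    clusterWeight E J K [a, b, c] = 0 :=
  clusterWeight_of_odd E J K (by decide : Odd 3)

theorem corr_eq_sum (o : V) (A : List V) :
    corr E J A = ∑ K : Finset V with o ∈ K,
      clusterWeight E J K (A.filter (· ∈ K)) * corr E (cut E J K) (A.filter (· ∉ K)) := by
  simpa using corr_mul_corr E J o A []

/-- The weight of the event that `K` is the cluster joining the sources `o` and `x`. -/
noncomputable def pairWeight (o x : V) (K : Finset V) : ℝ :=
  if o ∈ K ∧ x ∈ K then clusterWeight E J K [o, x] else 0

/-- The weight of the event that `K` is the common cluster of four sources. -/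
noncomputable def quadWeight (o x y z : V) (K : Finset V) : ℝ :=
  if o ∈ K ∧ x ∈ K ∧ y ∈ K ∧ z ∈ K then clusterWeight E J K [o, x, y, z] else 0

/-- The weight of the event that four sources lie in a common cluster. -/
noncomputable def jointWeight (o x y z : V) : ℝ := ∑ K, quadWeight E J o x y z K

/-- The two-point function of `y` and `z` after deletion of the edges touching `K`, set to `0` when
`y` or `z` itself lies in `K`. -/
noncomputable def corrOff (K : Finset V) (y z : V) : ℝ :=
  if y ∈ K ∨ z ∈ K then 0 else corr E (cut E J K) [y, z]

variable {J} in
lemma pairWeight_nonneg (hJ : ∀ e, 0 ≤ J e) (o x : V) (K : Finset V) :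
    0 ≤ pairWeight E J o x K := by
  unfold pairWeight
  split_ifs
  exacts [clusterWeight_nonneg E hJ K _, le_rfl]

variable {J} in
lemma quadWeight_nonneg (hJ : ∀ e, 0 ≤ J e) (o x y z : V) (K : Finset V) :
    0 ≤ quadWeight E J o x y z K := by
  unfold quadWeight
  split_ifs
  exacts [clusterWeight_nonneg E hJ K _, le_rfl]

variable {J} in
lemma jointWeight_nonneg (hJ : ∀ e, 0 ≤ J e) (o x y z : V) : 0 ≤ jointWeight E J o x y z :=
  sum_nonneg fun K _ => quadWeight_nonneg E hJ o x y z K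

lemma quadWeight_right_comm (o x y z : V) (K : Finset V) :
    quadWeight E J o x y z K = quadWeight E J o x z y K := by
  rw [quadWeight, quadWeight, clusterWeight_congr E J K (l' := [o, x, z, y]) fun σ => by
    simp only [spinProd_cons, spinProd_nil]; ring]
  exact if_congr (by tauto) rfl rfl

lemma quadWeight_left_comm (o x y z : V) (K : Finset V) :
    quadWeight E J o x y z K = quadWeight E J o y x z K := by
  rw [quadWeight, quadWeight, clusterWeight_congr E J K (l' := [o, y, x, z]) fun σ => by
    simp only [spinProd_cons, spinProd_nil]; ring]
  exact if_congr (by tauto) rfl rfl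

lemma jointWeight_right_comm (o x y z : V) :
    jointWeight E J o x y z = jointWeight E J o x z y :=
  sum_congr rfl fun K _ => quadWeight_right_comm E J o x y z K

lemma jointWeight_left_comm (o x y z : V) :
    jointWeight E J o x y z = jointWeight E J o y x z :=
  sum_congr rfl fun K _ => quadWeight_left_comm E J o x y z K

lemma corr_pair_mul_corr_pair (o x y z : V) :
    corr E J [o, x] * corr E J [y, z] =
      jointWeight E J o x y z + ∑ K, pairWeight E J o x K * corrOff E J K y z := by
  rw [corr_mul_corr E J o, sum_filter, jointWeight, ← sum_add_distrib]
  refine sum_congr rfl fun K _ => ?_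
  by_cases ho : o ∈ K <;> by_cases hx : x ∈ K <;> by_cases hy : y ∈ K <;> by_cases hz : z ∈ K <;>
    simp [quadWeight, pairWeight, corrOff, ho, hx, hy, hz]

theorem corr_four (o x y z : V) :
    corr E J [o, x, y, z] = corr E J [o, x] * corr E J [y, z] + corr E J [o, y] * corr E J [x, z] +
      corr E J [o, z] * corr E J [x, y] - 2 * jointWeight E J o x y z := by
  have hsum : corr E J [o, x, y, z] = jointWeight E J o x y z +
      ∑ K, pairWeight E J o x K * corrOff E J K y z +
      ∑ K, pairWeight E J o y K * corrOff E J K x z +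
      ∑ K, pairWeight E J o z K * corrOff E J K x y := by
    rw [corr_eq_sum E J o, sum_filter, jointWeight, ← sum_add_distrib, ← sum_add_distrib,
      ← sum_add_distrib]
    refine sum_congr rfl fun K _ => ?_
    by_cases ho : o ∈ K <;> by_cases hx : x ∈ K <;> by_cases hy : y ∈ K <;>
      by_cases hz : z ∈ K <;> simp [quadWeight, pairWeight, corrOff, ho, hx, hy, hz]
  have hy := corr_pair_mul_corr_pair E J o y x z
  have hz := corr_pair_mul_corr_pair E J o z x y
  rw [← jointWeight_left_comm] at hy
  rw [jointWeight_left_comm, jointWeight_right_comm] at hz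
  linarith [corr_pair_mul_corr_pair E J o x y z]

lemma sum_pairWeight_of_mem (o x u : V) :
    ∑ K with u ∈ K, pairWeight E J o x K = corr E J [o, u] * corr E J [u, x] := by
  rw [corr_mul_corr E J o, sum_filter, sum_filter]
  refine sum_congr rfl fun K _ => ?_
  have hcancel : clusterWeight E J K [o, u, u, x] = clusterWeight E J K [o, x] :=
    clusterWeight_congr E J K fun σ => by
      simp only [spinProd_cons, spinProd_nil]
      linear_combination spin σ o * spin σ x * spin_mul_self σ u
  by_cases ho : o ∈ K <;> by_cases hx : x ∈ K <;> by_cases hu : u ∈ K <;>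
    simp [pairWeight, ho, hx, hu, hcancel]

lemma sum_pairWeight (o x : V) : ∑ K, pairWeight E J o x K = corr E J [o, x] := by
  have hmem : ∑ K with x ∈ K, pairWeight E J o x K = ∑ K, pairWeight E J o x K :=
    sum_filter_of_ne fun K _ hK => (ite_ne_right_iff.1 hK).1.2
  rw [← hmem, sum_pairWeight_of_mem, corr_pair_self, mul_one]

theorem jointWeight_eq_sum (o x y z : V) :
    jointWeight E J o x y z =
      ∑ K, pairWeight E J o x K * (corr E J [y, z] - corrOff E J K y z) := by
  simp only [mul_sub, sum_sub_distrib, ← sum_mul, sum_pairWeight]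
  linarith [corr_pair_mul_corr_pair E J o x y z]

lemma sum_pairWeight_mul_corrOff (v x y : V) :
    ∑ K, pairWeight E J v v K * corrOff E J K x y =
      corr E J [x, y] - corr E J [x, v] * corr E J [v, y] := by
  have hfour : corr E J [v, v, x, y] = corr E J [x, y] :=
    corr_congr E J fun σ => by
      simp only [spinProd_cons, spinProd_nil]
      linear_combination spin σ x * spin σ y * spin_mul_self σ v
  have h := corr_four E J v v x y
  have h' := corr_pair_mul_corr_pair E J v v x y
  rw [hfour, corr_pair_self, one_mul, corr_pair_comm E J v x] at h
  rw [corr_pair_self, one_mul] at h'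
  linarith

/-- The contribution of the cluster `K` of `y` to the covariance of `σ_y σ_z` with the sources `B`:
the sources in `K` are paired with `y`, the remaining ones with `z`. -/
noncomputable def splitWeight (y z : V) (B : List V) (K : Finset V) : ℝ :=
  clusterWeight E J K (y :: B.filter (· ∈ K)) * corr E (cut E J K) (z :: B.filter (· ∉ K))

variable {J} in
lemma splitWeight_nonneg (hJ : ∀ e, 0 ≤ J e) (y z : V) (B : List V) (K : Finset V) :
    0 ≤ splitWeight E J y z B K :=
  mul_nonneg (clusterWeight_nonneg E hJ K _) (corr_nonneg E (cut_nonneg E hJ K) _)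

theorem corr_pair_append_sub (y z : V) (B : List V) :
    corr E J (y :: z :: B) - corr E J [y, z] * corr E J B =
      ∑ K : Finset V with y ∈ K ∧ z ∉ K, splitWeight E J y z B K := by
  rw [corr_eq_sum E J y, corr_mul_corr E J y, ← sum_sub_distrib, sum_filter, sum_filter]
  refine sum_congr rfl fun K _ => ?_
  have hodd : ∀ {l : List V}, ¬ Even l.length → clusterWeight E J K l = 0 :=
    fun hl => clusterWeight_of_odd E J K (Nat.not_even_iff_odd.1 hl)
  by_cases hy : y ∈ K <;> by_cases hz : z ∈ K <;> by_cases hB : Even (B.filter (· ∈ K)).length <;>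
    simp [splitWeight, hy, hz, hB, hodd, Nat.even_add_one]

end ClusterExpansions

section Griffiths

variable {V : Type} {ι : Type*} [Fintype V] [DecidableEq V] [Fintype ι] (E : ι → V × V)

lemma hasDerivAt_sum_spinProd_weight {J : ℝ → ι → ℝ} {J' : ι → ℝ} {s : ℝ}
    (hJ : ∀ e, HasDerivAt (fun s => J s e) (J' e) s) (l : List V) :
    HasDerivAt (fun s => ∑ σ : SpinConfig V, spinProd l σ * weight E (J s) σ)
      (weightSum E (J s) * ∑ e, J' e * corr E (J s) (l ++ [(E e).1, (E e).2])) s := by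
  have hterm : HasDerivAt (fun s => ∑ σ : SpinConfig V, spinProd l σ * weight E (J s) σ)
      (∑ σ : SpinConfig V, spinProd l σ * (weight E (J s) σ * ∑ e, J' e * bond E e σ)) s :=
    .fun_sum fun σ _ => .const_mul _ (.exp (.fun_sum fun e _ => (hJ e).mul_const _))
  convert hterm using 1
  rw [mul_sum]
  simp only [mul_left_comm (weightSum E (J s)), mul_comm (weightSum E (J s)),
    ← sum_spinProd_mul_weight, mul_sum]
  rw [sum_comm]
  refine sum_congr rfl fun σ _ => sum_congr rfl fun e _ => ?_
  simp only [spinProd_append, spinProd_cons, spinProd_nil, bond]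
  ring

theorem hasDerivAt_corr {J : ℝ → ι → ℝ} {J' : ι → ℝ} {s : ℝ}
    (hJ : ∀ e, HasDerivAt (fun s => J s e) (J' e) s) (l : List V) :
    HasDerivAt (fun s => corr E (J s) l)
      (∑ e, J' e * (corr E (J s) (l ++ [(E e).1, (E e).2]) -
        corr E (J s) l * corr E (J s) [(E e).1, (E e).2])) s := by
  have hZ := (weightSum_pos E (J s)).ne'
  have hnum := hasDerivAt_sum_spinProd_weight E hJ l
  have hden : HasDerivAt (fun s => weightSum E (J s))
      (weightSum E (J s) * ∑ e, J' e * corr E (J s) [(E e).1, (E e).2]) s := by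
    simpa [weightSum] using hasDerivAt_sum_spinProd_weight E hJ []
  refine (hnum.div hden hZ).congr_deriv ?_
  rw [sum_spinProd_mul_weight]
  have hsplit : ∑ e, J' e * (corr E (J s) (l ++ [(E e).1, (E e).2]) -
        corr E (J s) l * corr E (J s) [(E e).1, (E e).2]) =
      ∑ e, J' e * corr E (J s) (l ++ [(E e).1, (E e).2]) -
        corr E (J s) l * ∑ e, J' e * corr E (J s) [(E e).1, (E e).2] := by
    simp only [mul_sub, sum_sub_distrib, mul_sum, mul_left_comm]
  rw [hsplit]
  field_simp

variable {J : ι → ℝ} (hJ : ∀ e, 0 ≤ J e)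
include hJ

/-- Griffiths' second inequality, for a pair of sites. -/
theorem corr_pair_mul_le (y z : V) (B : List V) :
    corr E J [y, z] * corr E J B ≤ corr E J (y :: z :: B) := by
  rw [← sub_nonneg, corr_pair_append_sub]
  exact sum_nonneg fun K _ => splitWeight_nonneg E hJ y z B K

theorem corr_pair_mono {J' : ι → ℝ} (hJJ' : ∀ e, J e ≤ J' e) (x y : V) :
    corr E J [x, y] ≤ corr E J' [x, y] := by
  have hline : ∀ s : ℝ, ∀ e, HasDerivAt (fun s : ℝ => J e + s * (J' e - J e)) (J' e - J e) s :=
    fun s e => by simpa using ((hasDerivAt_id s).mul_const (J' e - J e)).const_add (J e)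
  have hderiv := fun s => hasDerivAt_corr E (hline s) [x, y]
  have hmono : MonotoneOn (fun s : ℝ => corr E (fun e => J e + s * (J' e - J e)) [x, y])
      (Set.Icc 0 1) := by
    refine monotoneOn_of_deriv_nonneg (convex_Icc 0 1)
      (fun s _ => (hderiv s).continuousAt.continuousWithinAt)
      (fun s _ => (hderiv s).differentiableAt.differentiableWithinAt) fun s hs => ?_
    rw [interior_Icc] at hs
    rw [(hderiv s).deriv]
    refine sum_nonneg fun e _ => mul_nonneg (sub_nonneg.2 (hJJ' e)) (sub_nonneg.2 ?_)
    exact corr_pair_mul_le E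
      (fun e => add_nonneg (hJ e) (mul_nonneg hs.1.le (sub_nonneg.2 (hJJ' e)))) x y _
  simpa using hmono (Set.left_mem_Icc.2 zero_le_one) (Set.right_mem_Icc.2 zero_le_one) zero_le_one

lemma corr_cut_le (K : Finset V) (x y : V) : corr E (cut E J K) [x, y] ≤ corr E J [x, y] :=
  corr_pair_mono E (cut_nonneg E hJ K) (cut_le E hJ K) x y

lemma corrOff_nonneg (K : Finset V) (x y : V) : 0 ≤ corrOff E J K x y := by
  unfold corrOff
  split_ifs
  exacts [le_rfl, corr_nonneg E (cut_nonneg E hJ K) _]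

lemma corrOff_le (K : Finset V) (x y : V) : corrOff E J K x y ≤ corr E J [x, y] := by
  unfold corrOff
  split_ifs
  exacts [corr_nonneg E hJ _, corr_cut_le E hJ K x y]

lemma jointWeight_le (o x y z : V) :
    jointWeight E J o x y z ≤ corr E J [o, x] * corr E J [y, z] := by
  rw [corr_pair_mul_corr_pair]
  exact le_add_of_nonneg_right <| sum_nonneg fun K _ =>
    mul_nonneg (pairWeight_nonneg E hJ o x K) (corrOff_nonneg E hJ K y z)

omit hJ in
lemma sum_pairWeight_of_mem_of_mem (o x u v : V) :
    ∑ K with u ∈ K ∧ v ∈ K, pairWeight E J o x K = ∑ K, pairWeight E J v v K *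
      (corr E J [o, u] * corr E J [u, x] - corrOff E J K o u * corrOff E J K u x) := by
  have hone : ∑ K, pairWeight E J v v K = 1 := by rw [sum_pairWeight, corr_pair_self]
  have hcancel : ∀ K, clusterWeight E J K [o, u, u, x] = clusterWeight E J K [o, x] :=
    fun K => clusterWeight_congr E J K fun σ => by
      simp only [spinProd_cons, spinProd_nil]
      linear_combination spin σ o * spin σ x * spin_mul_self σ u
  have hsquare : ∀ K, clusterWeight E J K [v, v] = clusterWeight E J K [] :=
    fun K => clusterWeight_congr E J K fun σ => by simp [spin_mul_self]
  simp only [mul_sub, sum_sub_distrib]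
  rw [← sum_mul, hone, one_mul, corr_mul_corr E J v, sum_filter, sum_filter, ← sum_sub_distrib]
  refine sum_congr rfl fun K _ => ?_
  by_cases hv : v ∈ K <;> by_cases ho : o ∈ K <;> by_cases hx : x ∈ K <;> by_cases hu : u ∈ K <;>
    simp [pairWeight, corrOff, ho, hx, hu, hv, hcancel, hsquare, mul_assoc]

/-- The tree bound for a cluster through four points: decouple `v` from each of the two factors
`⟨σ_o σ_u⟩` and `⟨σ_u σ_x⟩` separately. -/
theorem sum_pairWeight_of_mem_of_mem_le (o x u v : V) :
    ∑ K with u ∈ K ∧ v ∈ K, pairWeight E J o x K ≤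
      corr E J [o, u] * corr E J [u, v] * corr E J [v, x] +
        corr E J [o, v] * corr E J [v, u] * corr E J [u, x] := by
  have hdecouple : ∀ a b, corr E J [a, v] * corr E J [v, b] =
      ∑ K, pairWeight E J v v K * (corr E J [a, b] - corrOff E J K a b) := fun a b => by
    simp only [mul_sub, sum_sub_distrib, ← sum_mul, sum_pairWeight, corr_pair_self, one_mul,
      sum_pairWeight_mul_corrOff]
    ring
  rw [sum_pairWeight_of_mem_of_mem, mul_assoc, hdecouple u x, hdecouple o u, mul_sum, sum_mul,
    ← sum_add_distrib]
  refine sum_le_sum fun K _ => ?_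
  rw [mul_left_comm, mul_assoc, ← mul_add]
  refine mul_le_mul_of_nonneg_left ?_ (pairWeight_nonneg E hJ v v K)
  nlinarith [mul_nonneg (sub_nonneg.2 (corrOff_le E hJ K o u))
    (sub_nonneg.2 (corrOff_le E hJ K u x))]

end Griffiths

section Cumulants

variable {V : Type} {ι : Type*} [Fintype V] [DecidableEq V] [Fintype ι]
  (E : ι → V × V) (J : ι → ℝ)

/-- The covariance of `σ_y σ_z` and `σ_u σ_v`. -/
noncomputable def pairCov (y z u v : V) : ℝ :=
  corr E J [y, z, u, v] - corr E J [y, z] * corr E J [u, v]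

/-- The third cumulant of `σ_y σ_z`, `σ_u σ_v` and `σ_u' σ_v'`. -/
noncomputable def pairCumulant (y z u v u' v' : V) : ℝ :=
  corr E J [y, z, u, v, u', v'] - corr E J [y, z] * corr E J [u, v, u', v'] -
    corr E J [u, v] * pairCov E J y z u' v' - corr E J [u', v'] * pairCov E J y z u v

/-- The contribution of the cluster `K` of `y` to the third cumulant of `σ_y σ_z`, `σ_a σ_b` and
`σ_c σ_d` when `K` separates `a` from `b`, `c` and `d`. -/
noncomputable def starWeight (y z a b c d : V) (K : Finset V) : ℝ :=
  pairWeight E J y a K *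
      (corr E J [b, c] * corr E J [z, d] + corr E J [b, d] * corr E J [z, c]) +
    quadWeight E J y b c d K * corr E J [z, a]

/-- An upper bound for the sum of `starWeight` over all clusters, in terms of two-point
functions only. -/
noncomputable def starBound (y z a b c d : V) : ℝ :=
  corr E J [y, a] * (corr E J [b, c] * corr E J [z, d] + corr E J [b, d] * corr E J [z, c]) +
    (corr E J [y, c] * corr E J [b, d] + corr E J [y, d] * corr E J [b, c]) / 2 * corr E J [z, a]

lemma pairCumulant_eq_sum (y z u v u' v' : V) :
    pairCumulant E J y z u v u' v' = ∑ K : Finset V with y ∈ K ∧ z ∉ K,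
      (splitWeight E J y z [u, v, u', v'] K - corr E J [u, v] * splitWeight E J y z [u', v'] K -
        corr E J [u', v'] * splitWeight E J y z [u, v] K) := by
  simp only [pairCumulant, pairCov, corr_pair_append_sub, sum_sub_distrib, mul_sum]

variable {J} (hJ : ∀ e, 0 ≤ J e)
include hJ

lemma pairCov_nonneg (y z u v : V) : 0 ≤ pairCov E J y z u v :=
  sub_nonneg.2 (corr_pair_mul_le E hJ y z [u, v])

lemma starWeight_nonneg (y z a b c d : V) (K : Finset V) : 0 ≤ starWeight E J y z a b c d K := by
  have hG := fun x x' => corr_nonneg E hJ [x, x']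
  exact add_nonneg
    (mul_nonneg (pairWeight_nonneg E hJ y a K) (add_nonneg (mul_nonneg (hG b c) (hG z d))
      (mul_nonneg (hG b d) (hG z c))))
    (mul_nonneg (quadWeight_nonneg E hJ y b c d K) (hG z a))

lemma corr_cut_four_le (K : Finset V) (a b c d : V) :
    corr E (cut E J K) [a, b, c, d] ≤ corr E (cut E J K) [a, b] * corr E J [c, d] +
      (corr E J [b, c] * corr E J [a, d] + corr E J [b, d] * corr E J [a, c]) := by
  have hle := corr_cut_le E hJ K
  have hcut := fun x x' => corr_nonneg E (cut_nonneg E hJ K) [x, x']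
  have hG := fun x x' => corr_nonneg E hJ [x, x']
  calc corr E (cut E J K) [a, b, c, d]
      ≤ corr E (cut E J K) [a, b] * corr E (cut E J K) [c, d] +
        (corr E (cut E J K) [b, c] * corr E (cut E J K) [a, d] +
          corr E (cut E J K) [b, d] * corr E (cut E J K) [a, c]) := by
        linarith [corr_four E (cut E J K) a b c d,
          jointWeight_nonneg E (cut_nonneg E hJ K) a b c d]
    _ ≤ _ := by
        gcongr
        exacts [hcut a b, hle c d, hcut a d, hG b c, hle b c, hle a d, hcut a c, hG b d, hle b d,
          hle a c]

/-- The disconnected part of the four-point function of `z`, `b`, `c` and `d` cancels against the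
subtracted covariance. -/
lemma pairWeight_mul_sub_le_starWeight (y z a b c d : V) (K : Finset V) :
    pairWeight E J y a K * corr E (cut E J K) [z, b, c, d] -
      corr E J [c, d] * (pairWeight E J y a K * corr E (cut E J K) [z, b]) ≤
        starWeight E J y z a b c d K := by
  have hfour := mul_le_mul_of_nonneg_left (corr_cut_four_le E hJ K z b c d)
    (pairWeight_nonneg E hJ y a K)
  have hquad := mul_nonneg (quadWeight_nonneg E hJ y b c d K) (corr_nonneg E hJ [z, a])
  rw [starWeight]
  linarith

lemma quadWeight_mul_corr_cut_le_starWeight (y z a b c d : V) (K : Finset V) :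
    quadWeight E J y b c d K * corr E (cut E J K) [z, a] ≤ starWeight E J y z a b c d K := by
  have hG := fun x x' => corr_nonneg E hJ [x, x']
  have hcut := mul_le_mul_of_nonneg_left (corr_cut_le E hJ K z a) (quadWeight_nonneg E hJ y b c d K)
  have hpair := mul_nonneg (pairWeight_nonneg E hJ y a K) (add_nonneg
    (mul_nonneg (hG b c) (hG z d)) (mul_nonneg (hG b d) (hG z c)))
  rw [starWeight]
  linarith

lemma splitWeight_sub_le_sum_starWeight (y z u v u' v' : V) {K : Finset V} (hy : y ∈ K) :
    splitWeight E J y z [u, v, u', v'] K - corr E J [u, v] * splitWeight E J y z [u', v'] K -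
        corr E J [u', v'] * splitWeight E J y z [u, v] K ≤
      starWeight E J y z u v u' v' K + starWeight E J y z v u u' v' K +
        (starWeight E J y z u' v' u v K + starWeight E J y z v' u' u v K) := by
  have hcorr : ∀ w, corr E (cut E J K) [z, u, v, w] = corr E (cut E J K) [z, w, u, v] := fun w =>
    corr_congr _ _ fun σ => by simp only [spinProd_cons, spinProd_nil]; ring
  have hcluster : ∀ w, clusterWeight E J K [y, u, v, w] = clusterWeight E J K [y, w, u, v] :=
    fun w => clusterWeight_congr _ _ _ fun σ => by simp only [spinProd_cons, spinProd_nil]; ring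
  have hprod : ∀ a b c d, 0 ≤ corr E J [a, b] *
      (clusterWeight E J K [y, c] * corr E (cut E J K) [z, d]) := fun a b c d =>
    mul_nonneg (corr_nonneg E hJ _)
      (mul_nonneg (clusterWeight_nonneg E hJ K _) (corr_nonneg E (cut_nonneg E hJ K) _))
  have hstar := fun a b c d => starWeight_nonneg E hJ y z a b c d K
  have hpair := fun a b c d => pairWeight_mul_sub_le_starWeight E hJ y z a b c d K
  have hquad := fun a b c d => quadWeight_mul_corr_cut_le_starWeight E hJ y z a b c d K
  have hpu := hpair u v u' v'
  have hpv := hpair v u u' v'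
  have hpu' := hpair u' v' u v
  have hpv' := hpair v' u' u v
  have hqu := hquad u v u' v'
  have hqv := hquad v u u' v'
  have hqu' := hquad u' v' u v
  have hqv' := hquad v' u' u v
  by_cases hu : u ∈ K <;> by_cases hv : v ∈ K <;> by_cases hu' : u' ∈ K <;>
    by_cases hv' : v' ∈ K <;>
    simp [splitWeight, pairWeight, quadWeight, hy, hu, hv, hu', hv', hcorr, hcluster,
      clusterWeight_of_odd, Nat.odd_iff] at hpu hpv hpu' hpv' hqu hqv hqu' hqv' ⊢ <;>
    linarith [hprod u v u' v', hprod u v v' u', hprod u' v' u v, hprod u' v' v u,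
      hstar u v u' v', hstar v u u' v', hstar u' v' u v, hstar v' u' u v]

lemma sum_starWeight_le (y z a b c d : V) :
    ∑ K, starWeight E J y z a b c d K ≤ starBound E J y z a b c d := by
  have hjoint : jointWeight E J y b c d ≤
      (corr E J [y, c] * corr E J [b, d] + corr E J [y, d] * corr E J [b, c]) / 2 := by
    have hc := jointWeight_le E hJ y c b d
    have hd := jointWeight_le E hJ y d b c
    rw [← jointWeight_left_comm] at hc
    rw [jointWeight_left_comm, jointWeight_right_comm] at hd
    linarith
  simp only [starWeight, sum_add_distrib, ← sum_mul, sum_pairWeight]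
  exact add_le_add_right (mul_le_mul_of_nonneg_right hjoint (corr_nonneg E hJ _)) _

theorem pairCumulant_le (y z u v u' v' : V) :
    pairCumulant E J y z u v u' v' ≤
      starBound E J y z u v u' v' + starBound E J y z v u u' v' +
        (starBound E J y z u' v' u v + starBound E J y z v' u' u v) := by
  have hstar := fun a b c d K => starWeight_nonneg E hJ y z a b c d K
  rw [pairCumulant_eq_sum]
  calc ∑ K : Finset V with y ∈ K ∧ z ∉ K,
        (splitWeight E J y z [u, v, u', v'] K - corr E J [u, v] * splitWeight E J y z [u', v'] K -
          corr E J [u', v'] * splitWeight E J y z [u, v] K)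
      ≤ ∑ K : Finset V with y ∈ K ∧ z ∉ K,
          (starWeight E J y z u v u' v' K + starWeight E J y z v u u' v' K +
            (starWeight E J y z u' v' u v K + starWeight E J y z v' u' u v K)) :=
        sum_le_sum fun K hK =>
          splitWeight_sub_le_sum_starWeight E hJ y z u v u' v' ((mem_filter_univ K).1 hK).1
    _ ≤ ∑ K, (starWeight E J y z u v u' v' K + starWeight E J y z v u u' v' K +
            (starWeight E J y z u' v' u v K + starWeight E J y z v' u' u v K)) :=
        sum_le_univ_sum_of_nonneg fun K => add_nonneg (add_nonneg (hstar _ _ _ _ K)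
          (hstar _ _ _ _ K)) (add_nonneg (hstar _ _ _ _ K) (hstar _ _ _ _ K))
    _ ≤ _ := by
        simp only [sum_add_distrib]
        gcongr <;> exact sum_starWeight_le E hJ _ _ _ _ _ _

lemma starBound_mono {J' : ι → ℝ} (hJJ' : ∀ e, J e ≤ J' e) (y z a b c d : V) :
    starBound E J y z a b c d ≤ starBound E J' y z a b c d := by
  have hle := corr_pair_mono E hJ hJJ'
  have hG := fun x x' => corr_nonneg E hJ [x, x']
  have hG' := fun x x' => (hG x x').trans (hle x x')
  unfold starBound
  gcongr <;> apply_rules [hle, hG, hG', div_nonneg, add_nonneg, mul_nonneg, zero_le_two]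

omit hJ in
lemma sum_starBound {χ : ℝ} (hχ : ∀ u, ∑ y, corr E J [y, u] = χ) (a b c d : V) :
    ∑ y, ∑ z, starBound E J y z a b c d =
      3 / 2 * χ ^ 2 * (corr E J [b, c] + corr E J [b, d]) := by
  simp only [starBound, mul_add, add_mul, add_div, sum_add_distrib, ← mul_sum, ← sum_mul,
    ← sum_div, hχ]
  ring

/-- The sum of the two-point functions between the ends of two edges. -/
noncomputable def bondSum (E : ι → V × V) (J : ι → ℝ) (e e' : ι) : ℝ :=
  corr E J [(E e).1, (E e').1] + corr E J [(E e).1, (E e').2] +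
    (corr E J [(E e).2, (E e').1] + corr E J [(E e).2, (E e').2])

lemma bondSum_nonneg (e e' : ι) : 0 ≤ bondSum E J e e' :=
  add_nonneg (add_nonneg (corr_nonneg E hJ _) (corr_nonneg E hJ _))
    (add_nonneg (corr_nonneg E hJ _) (corr_nonneg E hJ _))

omit hJ in
lemma bondSum_comm (e e' : ι) : bondSum E J e e' = bondSum E J e' e := by
  simp only [bondSum, corr_pair_comm E J (E e).1, corr_pair_comm E J (E e).2]
  ring

theorem sum_pairCumulant_le {J₀ : ι → ℝ} (hJJ₀ : ∀ e, J e ≤ J₀ e) {χ : ℝ}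
    (hχ : ∀ u, ∑ y, corr E J₀ [y, u] = χ) (e e' : ι) :
    ∑ y, ∑ z, pairCumulant E J y z (E e).1 (E e).2 (E e').1 (E e').2 ≤
      3 * χ ^ 2 * bondSum E J₀ e e' := by
  have hmono := starBound_mono E hJ hJJ₀
  calc ∑ y, ∑ z, pairCumulant E J y z (E e).1 (E e).2 (E e').1 (E e').2
      ≤ ∑ y, ∑ z, (starBound E J₀ y z (E e).1 (E e).2 (E e').1 (E e').2 +
          starBound E J₀ y z (E e).2 (E e).1 (E e').1 (E e').2 +
          (starBound E J₀ y z (E e').1 (E e').2 (E e).1 (E e).2 +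
            starBound E J₀ y z (E e').2 (E e').1 (E e).1 (E e).2)) := by
        refine sum_le_sum fun y _ => sum_le_sum fun z _ => (pairCumulant_le E hJ ..).trans ?_
        gcongr <;> apply hmono
    _ = 3 / 2 * χ ^ 2 * (bondSum E J₀ e e' + bondSum E J₀ e' e) := by
        simp only [sum_add_distrib, sum_starBound E hχ, bondSum]
        ring
    _ = 3 * χ ^ 2 * bondSum E J₀ e e' := by
        rw [bondSum_comm E e' e]
        ring

end Cumulants

lemma le_quadratic_of_deriv_two_le {f f' f'' : ℝ → ℝ} {C t : ℝ} (ht : 0 ≤ t)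
    (hf : ∀ s, HasDerivAt f (f' s) s) (hf' : ∀ s, HasDerivAt f' (f'' s) s)
    (hC : ∀ s ∈ Set.Ico 0 t, f'' s ≤ C) : f t ≤ f 0 + t * f' 0 + C * t ^ 2 / 2 := by
  have hlin : ∀ s, HasDerivAt (fun s => f' 0 + C * s) C s := fun s => by
    simpa using ((hasDerivAt_id s).const_mul C).const_add (f' 0)
  have hquad : ∀ s, HasDerivAt (fun s => f 0 + s * f' 0 + C * s ^ 2 / 2) (f' 0 + C * s) s :=
    fun s => by
      refine ((((hasDerivAt_id s).mul_const (f' 0)).const_add (f 0)).add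
        ((((hasDerivAt_id s).pow 2).const_mul C).div_const 2)).congr_deriv ?_
      simp only [id_eq, Nat.cast_ofNat, one_mul, mul_one, Nat.add_one_sub_one, pow_one]
      ring
  have hderiv : ∀ s ∈ Set.Icc 0 t, f' s ≤ f' 0 + C * s :=
    image_le_of_deriv_right_le_deriv_boundary
      (fun s _ => (hf' s).continuousAt.continuousWithinAt) (fun s _ => (hf' s).hasDerivWithinAt)
      (by simp) (fun s _ => (hlin s).continuousAt.continuousWithinAt)
      (fun s _ => (hlin s).hasDerivWithinAt) hC
  exact image_le_of_deriv_right_le_deriv_boundary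
    (fun s _ => (hf s).continuousAt.continuousWithinAt) (fun s _ => (hf s).hasDerivWithinAt)
    (by simp) (fun s _ => (hquad s).continuousAt.continuousWithinAt)
    (fun s _ => (hquad s).hasDerivWithinAt) (fun s hs => hderiv s ⟨hs.1, hs.2.le⟩)
    (Set.right_mem_Icc.2 ht)

section Deficit

variable {V : Type} {ι : Type*} [Fintype V] [DecidableEq V] [Fintype ι] (E : ι → V × V)

lemma hasDerivAt_pairCov {J : ℝ → ι → ℝ} {J' : ι → ℝ} {s : ℝ}
    (hJ : ∀ e, HasDerivAt (fun s => J s e) (J' e) s) (y z u v : V) :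
    HasDerivAt (fun s => pairCov E (J s) y z u v)
      (∑ e, J' e * pairCumulant E (J s) y z u v (E e).1 (E e).2) s := by
  refine ((hasDerivAt_corr E hJ [y, z, u, v]).sub
    ((hasDerivAt_corr E hJ [y, z]).mul (hasDerivAt_corr E hJ [u, v]))).congr_deriv ?_
  rw [sum_mul, mul_sum, ← sum_add_distrib, ← sum_sub_distrib]
  refine sum_congr rfl fun e _ => ?_
  simp only [pairCumulant, pairCov, List.cons_append, List.nil_append]
  ring

/-- The derivative of `∑_{y, z} ⟨σ_y σ_z⟩` with respect to the coupling of the edge `e`. -/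
noncomputable def totalCov (J : ι → ℝ) (e : ι) : ℝ :=
  ∑ y, ∑ z, pairCov E J y z (E e).1 (E e).2

lemma totalCov_nonneg {J : ι → ℝ} (hJ : ∀ e, 0 ≤ J e) (e : ι) : 0 ≤ totalCov E J e :=
  sum_nonneg fun y _ => sum_nonneg fun z _ => pairCov_nonneg E hJ y z _ _

lemma hasDerivAt_sum_corr {J : ℝ → ι → ℝ} {J' : ι → ℝ} {s : ℝ}
    (hJ : ∀ e, HasDerivAt (fun s => J s e) (J' e) s) :
    HasDerivAt (fun s => ∑ y, ∑ z, corr E (J s) [y, z]) (∑ e, J' e * totalCov E (J s) e) s := by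
  refine (HasDerivAt.fun_sum fun y _ => HasDerivAt.fun_sum fun z _ =>
    hasDerivAt_corr E hJ [y, z]).congr_deriv ?_
  simp only [totalCov, mul_sum, sum_comm (s := (univ : Finset ι)) (t := (univ : Finset V))]
  rfl

lemma hasDerivAt_totalCov {J : ℝ → ι → ℝ} {J' : ι → ℝ} {s : ℝ}
    (hJ : ∀ e, HasDerivAt (fun s => J s e) (J' e) s) (e : ι) :
    HasDerivAt (fun s => totalCov E (J s) e) (∑ e', J' e' *
      ∑ y, ∑ z, pairCumulant E (J s) y z (E e).1 (E e).2 (E e').1 (E e').2) s := by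
  refine (HasDerivAt.fun_sum fun y _ => HasDerivAt.fun_sum fun z _ =>
    hasDerivAt_pairCov E hJ y z (E e).1 (E e).2).congr_deriv ?_
  simp only [mul_sum, sum_comm (s := (univ : Finset ι)) (t := (univ : Finset V))]

variable {J : ι → ℝ} {χ : ℝ} (hχ : ∀ u, ∑ y, corr E J [y, u] = χ) {t : ℝ}
  (ht : t ∈ Set.Icc (0 : ℝ) 1)
include hχ ht

/-- A second-order Taylor bound, in which the third cumulants control the remainder. -/
theorem sum_corr_sub_corr_ge {c : ι → ℝ} (hc : ∀ e, 0 ≤ c e) (hcJ : ∀ e, c e ≤ J e) :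
    t * ∑ e, c e * totalCov E J e -
        t ^ 2 / 2 * (3 * χ ^ 2 * ∑ e, ∑ e', c e * c e' * bondSum E J e e') ≤
      ∑ y, ∑ z, (corr E J [y, z] - corr E (fun e => J e - t * c e) [y, z]) := by
  have hline : ∀ s e, HasDerivAt (fun s => J e - s * c e) (-c e) s := fun s e => by
    simpa using ((hasDerivAt_id s).mul_const (c e)).const_sub (J e)
  have hsecond : ∀ s ∈ Set.Ico 0 t, ∑ e, -c e * ∑ e', -c e' * ∑ y, ∑ z,
      pairCumulant E (fun e => J e - s * c e) y z (E e).1 (E e).2 (E e').1 (E e').2 ≤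
      3 * χ ^ 2 * ∑ e, ∑ e', c e * c e' * bondSum E J e e' := fun s hs => by
    have hJs : ∀ e, 0 ≤ J e - s * c e := fun e => by
      linarith [hcJ e, mul_le_mul_of_nonneg_right (hs.2.le.trans ht.2) (hc e)]
    have hJsJ : ∀ e, J e - s * c e ≤ J e := fun e =>
      sub_le_self _ (mul_nonneg hs.1 (hc e))
    rw [mul_sum]
    refine sum_le_sum fun e _ => ?_
    rw [mul_sum, mul_sum]
    refine sum_le_sum fun e' _ => ?_
    calc -c e * (-c e' * ∑ y, ∑ z, pairCumulant E (fun e => J e - s * c e) y z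
            (E e).1 (E e).2 (E e').1 (E e').2)
        = c e * c e' * ∑ y, ∑ z, pairCumulant E (fun e => J e - s * c e) y z
            (E e).1 (E e).2 (E e').1 (E e').2 := by ring
      _ ≤ c e * c e' * (3 * χ ^ 2 * bondSum E J e e') :=
          mul_le_mul_of_nonneg_left (sum_pairCumulant_le E hJs hJsJ hχ e e')
            (mul_nonneg (hc e) (hc e'))
      _ = 3 * χ ^ 2 * (c e * c e' * bondSum E J e e') := by ring
  have htaylor := le_quadratic_of_deriv_two_le ht.1
    (fun s => hasDerivAt_sum_corr E (hline s))
    (fun s => HasDerivAt.fun_sum fun e _ => (hasDerivAt_totalCov E (hline s) e).const_mul (-c e))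
    hsecond
  simp only [zero_mul, sub_zero, neg_mul, sum_neg_distrib] at htaylor
  simp only [sum_sub_distrib]
  linarith

end Deficit

section HalfEdges

variable {V : Type} {ι : Type*}

/-- The end of a half-edge; a half-edge is an edge together with a choice of one of its ends. -/
def foot (E : ι → V × V) (h : ι × Bool) : V := if h.2 then (E h.1).1 else (E h.1).2

variable [DecidableEq V] (E : ι → V × V) {J : ι → ℝ} (hJ : ∀ e, 0 ≤ J e) (K : Finset V)
include hJ

lemma sub_cut_le_sum_foot (e : ι) :
    J e - cut E J K e ≤ ∑ b, if foot E (e, b) ∈ K then J e else 0 := by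
  rw [Fintype.sum_bool]
  by_cases hfst : (E e).1 ∈ K <;> by_cases hsnd : (E e).2 ∈ K <;>
    simp [cut, foot, hfst, hsnd, hJ e]

lemma sum_foot_le_two_mul_sub_cut (e : ι) :
    ∑ b, (if foot E (e, b) ∈ K then J e else 0) ≤ 2 * (J e - cut E J K e) := by
  rw [Fintype.sum_bool]
  by_cases hfst : (E e).1 ∈ K <;> by_cases hsnd : (E e).2 ∈ K <;>
    simp [cut, foot, hfst, hsnd] <;> linarith [hJ e]

variable [Fintype ι]

lemma sum_half_edges_le {φ : ι → ℝ} (hφ : ∀ e, 0 ≤ φ e) :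
    ∑ h with foot E h ∈ K, J h.1 * φ h.1 ≤ 2 * ∑ e, (J e - cut E J K e) * φ e := by
  rw [sum_filter, Fintype.sum_prod_type, mul_sum]
  refine sum_le_sum fun e _ => ?_
  rw [← mul_assoc]
  refine le_trans (le_of_eq ?_)
    (mul_le_mul_of_nonneg_right (sum_foot_le_two_mul_sub_cut E hJ K e) (hφ e))
  simp only [sum_mul, ite_mul, zero_mul]

lemma le_sum_half_edges {φ : ι → ℝ} (hφ : ∀ e, 0 ≤ φ e) :
    ∑ e, (J e - cut E J K e) * φ e ≤ ∑ h with foot E h ∈ K, J h.1 * φ h.1 := by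
  rw [sum_filter, Fintype.sum_prod_type]
  refine sum_le_sum fun e _ => ?_
  refine (mul_le_mul_of_nonneg_right (sub_cut_le_sum_foot E hJ K e) (hφ e)).trans_eq ?_
  simp only [sum_mul, ite_mul, zero_mul]

variable [Fintype V]

theorem sum_corr_sub_corrOff_ge {χ : ℝ} (hχ : ∀ u, ∑ y, corr E J [y, u] = χ) {t : ℝ}
    (ht : t ∈ Set.Icc (0 : ℝ) 1) :
    t / 2 * ∑ h with foot E h ∈ K, J h.1 * totalCov E J h.1 -
        3 / 2 * t ^ 2 * χ ^ 2 * ∑ h with foot E h ∈ K,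
          ∑ h' with foot E h' ∈ K, J h.1 * J h'.1 * bondSum E J h.1 h'.1 ≤
      ∑ y, ∑ z, (corr E J [y, z] - corrOff E J K y z) := by
  let c : ι → ℝ := fun e => J e - cut E J K e
  have hc : ∀ e, 0 ≤ c e := fun e => sub_nonneg.2 (cut_le E hJ K e)
  have hcJ : ∀ e, c e ≤ J e := fun e => sub_le_self _ (cut_nonneg E hJ K e)
  have hoff : ∀ y z, corrOff E J K y z ≤ corr E (fun e => J e - t * c e) [y, z] := fun y z => by
    have hmono := corr_pair_mono E (cut_nonneg E hJ K) (J' := fun e => J e - t * c e)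
      (fun e => by linarith [mul_le_of_le_one_left (hc e) ht.2]) y z
    have hcut := corr_nonneg E (cut_nonneg E hJ K) [y, z]
    unfold corrOff
    split_ifs <;> linarith
  have hfirst : ∑ h with foot E h ∈ K, J h.1 * totalCov E J h.1 ≤ 2 * ∑ e, c e * totalCov E J e :=
    sum_half_edges_le E hJ K (totalCov_nonneg E hJ)
  have hsecond : ∑ e, ∑ e', c e * c e' * bondSum E J e e' ≤
      ∑ h with foot E h ∈ K, ∑ h' with foot E h' ∈ K, J h.1 * J h'.1 * bondSum E J h.1 h'.1 := by
    have hbond : ∀ e, 0 ≤ ∑ h' with foot E h' ∈ K, J h'.1 * bondSum E J e h'.1 := fun e =>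
      sum_nonneg fun h' _ => mul_nonneg (hJ h'.1) (bondSum_nonneg E hJ e h'.1)
    simp only [mul_assoc, ← mul_sum]
    refine le_trans (sum_le_sum fun e _ => ?_) (le_sum_half_edges E hJ K hbond)
    exact mul_le_mul_of_nonneg_left (le_sum_half_edges E hJ K (bondSum_nonneg E hJ e)) (hc e)
  calc _ ≤ t * ∑ e, c e * totalCov E J e -
          t ^ 2 / 2 * (3 * χ ^ 2 * ∑ e, ∑ e', c e * c e' * bondSum E J e e') := by
        have hfirst' := mul_le_mul_of_nonneg_left hfirst (div_nonneg ht.1 zero_le_two)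
        have hsecond' := mul_le_mul_of_nonneg_left hsecond
          (show 0 ≤ 3 / 2 * t ^ 2 * χ ^ 2 by positivity)
        linarith
    _ ≤ ∑ y, ∑ z, (corr E J [y, z] - corr E (fun e => J e - t * c e) [y, z]) :=
        sum_corr_sub_corr_ge E hχ ht hc hcJ
    _ ≤ _ := sum_le_sum fun y _ => sum_le_sum fun z _ => sub_le_sub_left (hoff y z) _

end HalfEdges

section JointWeight

variable {V : Type} {ι α : Type*} [Fintype V] [DecidableEq V] [Fintype ι] [Fintype α]
  (E : ι → V × V) {J : ι → ℝ} {χ : ℝ} (p : α → V)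

lemma sum_corr_right (hχ : ∀ u, ∑ y, corr E J [y, u] = χ) (u : V) :
    ∑ y, corr E J [u, y] = χ := by
  simpa only [corr_pair_comm E J u] using hχ u

lemma sum_sum_pairWeight_mul (hχ : ∀ u, ∑ y, corr E J [y, u] = χ) (o : V) (φ : α → ℝ) :
    ∑ x, ∑ K, pairWeight E J o x K * ∑ a with p a ∈ K, φ a =
      χ * ∑ a, corr E J [o, p a] * φ a := by
  have hsum : ∀ x, ∑ K, pairWeight E J o x K * ∑ a with p a ∈ K, φ a =
      ∑ a, corr E J [o, p a] * corr E J [p a, x] * φ a := fun x => by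
    simp only [sum_filter, mul_sum, mul_ite, mul_zero, ← sum_pairWeight_of_mem, sum_mul, ite_mul,
      zero_mul]
    exact sum_comm
  simp only [hsum]
  rw [sum_comm, mul_sum]
  refine sum_congr rfl fun a _ => ?_
  rw [← sum_mul, ← mul_sum, sum_corr_right E hχ]
  ring

lemma sum_sum_pairWeight_mul_le (hJ : ∀ e, 0 ≤ J e) (hχ : ∀ u, ∑ y, corr E J [y, u] = χ) (o : V)
    {ψ : α → α → ℝ} (hψ : ∀ a b, 0 ≤ ψ a b) (hψ_comm : ∀ a b, ψ a b = ψ b a) :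
    ∑ x, ∑ K, pairWeight E J o x K * ∑ a with p a ∈ K, ∑ b with p b ∈ K, ψ a b ≤
      2 * χ * ∑ a, corr E J [o, p a] * ∑ b, corr E J [p a, p b] * ψ a b := by
  have htree : ∀ x, ∑ K, pairWeight E J o x K * ∑ a with p a ∈ K, ∑ b with p b ∈ K, ψ a b ≤
      ∑ a, ∑ b, (corr E J [o, p a] * corr E J [p a, p b] * corr E J [p b, x] * ψ a b +
        corr E J [o, p b] * corr E J [p b, p a] * corr E J [p a, x] * ψ b a) := fun x => by
    calc ∑ K, pairWeight E J o x K * ∑ a with p a ∈ K, ∑ b with p b ∈ K, ψ a b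
        = ∑ a, ∑ b, (∑ K with p a ∈ K ∧ p b ∈ K, pairWeight E J o x K) * ψ a b := by
          simp only [sum_filter, sum_mul, mul_sum, ite_mul, mul_ite, zero_mul, mul_zero, ite_and,
            ite_sum_zero]
          rw [sum_comm]
          exact sum_congr rfl fun a _ => sum_comm
      _ ≤ _ := sum_le_sum fun a _ => sum_le_sum fun b _ => by
          rw [hψ_comm b a, ← add_mul]
          exact mul_le_mul_of_nonneg_right
            (sum_pairWeight_of_mem_of_mem_le E hJ o x (p a) (p b)) (hψ a b)
  have hpaths : ∑ x, ∑ a, ∑ b, corr E J [o, p a] * corr E J [p a, p b] * corr E J [p b, x] * ψ a b =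
      χ * ∑ a, corr E J [o, p a] * ∑ b, corr E J [p a, p b] * ψ a b := by
    rw [sum_comm, mul_sum]
    refine sum_congr rfl fun a _ => ?_
    rw [sum_comm, mul_sum, mul_sum]
    refine sum_congr rfl fun b _ => ?_
    rw [← sum_mul, ← mul_sum, sum_corr_right E hχ]
    ring
  refine (sum_le_sum fun x _ => htree x).trans_eq ?_
  simp only [sum_add_distrib, sum_comm (f := fun a b => _ * ψ b a), hpaths]
  ring

theorem sum_jointWeight_ge (hJ : ∀ e, 0 ≤ J e) (hχ : ∀ u, ∑ y, corr E J [y, u] = χ) (o : V)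
    {t : ℝ} (ht : t ∈ Set.Icc (0 : ℝ) 1) :
    t / 2 * χ * ∑ h, corr E J [o, foot E h] * (J h.1 * totalCov E J h.1) -
        3 * t ^ 2 * χ ^ 3 * ∑ h, corr E J [o, foot E h] *
          ∑ h', corr E J [foot E h, foot E h'] * (J h.1 * J h'.1 * bondSum E J h.1 h'.1) ≤
      ∑ x, ∑ y, ∑ z, jointWeight E J o x y z := by
  let first : Finset V → ℝ := fun K => ∑ h with foot E h ∈ K, J h.1 * totalCov E J h.1
  let second : Finset V → ℝ := fun K => ∑ h with foot E h ∈ K, ∑ h' with foot E h' ∈ K,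
    J h.1 * J h'.1 * bondSum E J h.1 h'.1
  have hfirst : ∑ x, ∑ K, pairWeight E J o x K * first K =
      χ * ∑ h, corr E J [o, foot E h] * (J h.1 * totalCov E J h.1) :=
    sum_sum_pairWeight_mul E (foot E) hχ o _
  have hsecond := sum_sum_pairWeight_mul_le E (foot E) hJ hχ o
    (ψ := fun h h' => J h.1 * J h'.1 * bondSum E J h.1 h'.1)
    (fun h h' => mul_nonneg (mul_nonneg (hJ _) (hJ _)) (bondSum_nonneg E hJ _ _))
    (fun h h' => by rw [bondSum_comm, mul_comm (J h.1)])
  calc _ ≤ t / 2 * ∑ x, ∑ K, pairWeight E J o x K * first K -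
          3 / 2 * t ^ 2 * χ ^ 2 * ∑ x, ∑ K, pairWeight E J o x K * second K := by
        rw [hfirst]
        have := mul_le_mul_of_nonneg_left hsecond (show 0 ≤ 3 / 2 * t ^ 2 * χ ^ 2 by positivity)
        linarith
    _ = ∑ x, ∑ K, pairWeight E J o x K *
          (t / 2 * first K - 3 / 2 * t ^ 2 * χ ^ 2 * second K) := by
        simp only [mul_sum, ← sum_sub_distrib]
        exact sum_congr rfl fun x _ => sum_congr rfl fun K _ => by ring
    _ ≤ ∑ x, ∑ K, pairWeight E J o x K * ∑ y, ∑ z, (corr E J [y, z] - corrOff E J K y z) :=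
        sum_le_sum fun x _ => sum_le_sum fun K _ => mul_le_mul_of_nonneg_left
          (sum_corr_sub_corrOff_ge E hJ K hχ ht) (pairWeight_nonneg E hJ o x K)
    _ = ∑ x, ∑ y, ∑ z, jointWeight E J o x y z := by
        simp only [jointWeight_eq_sum, mul_sum,
          sum_comm (s := (univ : Finset (Finset V))) (t := (univ : Finset V))]

end JointWeight

section Relabelling

variable {V : Type} {ι : Type*} [Fintype V] [DecidableEq V] [Fintype ι]
  {E : ι → V × V} {J : ι → ℝ}

lemma corr_map {φ : V ≃ V} {ψ : ι ≃ ι} (hE : ∀ e, E (ψ e) = (E e).map φ φ)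
    (hJ : ∀ e, J (ψ e) = J e) (l : List V) : corr E J (l.map φ) = corr E J l := by
  have hprod : ∀ σ : SpinConfig V, spinProd (l.map φ) σ = spinProd l (σ ∘ φ) := fun σ => by
    rw [spinProd, List.map_map]
    rfl
  have hweight : ∀ σ : SpinConfig V, weight E J σ = weight E J (σ ∘ φ) := fun σ => by
    rw [weight, weight, ← ψ.sum_comp]
    simp only [hJ, bond, hE]
    rfl
  rw [corr, corr, sum_congr rfl fun σ _ => by rw [hprod, hweight]]
  exact congrArg (· / _) ((φ.symm.arrowCongr (Equiv.refl ℤˣ)).sum_comp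
    fun σ => spinProd l σ * weight E J σ)

end Relabelling

section Ursell

variable {V : Type} {ι : Type*} [Fintype V] [DecidableEq V] [Fintype ι] (E : ι → V × V)

/-- The Ursell function `U₄(w, x, y, z)`. -/
noncomputable def ursell (J : ι → ℝ) (w x y z : V) : ℝ :=
  corr E J [w, x, y, z] - corr E J [w, x] * corr E J [y, z] - corr E J [w, y] * corr E J [x, z] -
    corr E J [w, z] * corr E J [x, y]

lemma abs_ursell {J : ι → ℝ} (hJ : ∀ e, 0 ≤ J e) (w x y z : V) :
    |ursell E J w x y z| = 2 * jointWeight E J w x y z := by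
  have hursell : ursell E J w x y z = -(2 * jointWeight E J w x y z) := by
    rw [ursell, corr_four]
    ring
  rw [hursell, abs_neg, abs_of_nonneg (mul_nonneg zero_le_two (jointWeight_nonneg E hJ w x y z))]

end Ursell

section Cayley

variable {V : Type} {κ : Type*} [AddCommGroup V]

/-- The edges `x — x + g i` of the Cayley multigraph of `V` with generators `g i`. -/
def cayleyEdge (g : κ → V) (q : V × κ) : V × V := (q.1, q.1 + g q.2)

lemma foot_cayleyEdge (g : κ → V) (x : V) (i : κ) (b : Bool) :
    foot (cayleyEdge g) ((x, i), b) = x + if b then 0 else g i := by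
  cases b <;> simp [foot, cayleyEdge]

variable [Fintype V] [DecidableEq V] [Fintype κ] (g : κ → V) (β : ℝ)

/-- The correlations of the Ising model on a Cayley multigraph with inverse temperature `β`. -/
noncomputable def cayleyCorr (l : List V) : ℝ := corr (cayleyEdge g) (fun _ => β) l

/-- The susceptibility `χ(β) = ∑_x ⟨σ_0 σ_x⟩` on a Cayley multigraph. -/
noncomputable def cayleySusceptibility : ℝ := ∑ x, cayleyCorr g β [0, x]

/-- The bubble diagram `B(β) = ∑_x ⟨σ_0 σ_x⟩ ^ 2` on a Cayley multigraph. -/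
noncomputable def cayleyBubble : ℝ := ∑ x, cayleyCorr g β [0, x] ^ 2

lemma cayleyCorr_translate (a : V) (l : List V) :
    cayleyCorr g β (l.map (· + a)) = cayleyCorr g β l :=
  corr_map (φ := Equiv.addRight a) (ψ := (Equiv.addRight a).prodCongr (Equiv.refl κ))
    (fun e => Prod.ext rfl (add_right_comm e.1 a (g e.2))) (fun _ => rfl) l

lemma sum_cayleyCorr (f : ℝ → ℝ) (u a : V) :
    ∑ x, f (cayleyCorr g β [u, x + a]) = ∑ x, f (cayleyCorr g β [0, x]) := by
  rw [← Equiv.sum_comp (Equiv.addRight (u - a))]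
  refine sum_congr rfl fun x _ => congrArg f ?_
  simpa [add_assoc] using cayleyCorr_translate g β u [0, x]

lemma sum_cayleyCorr_left (u : V) :
    ∑ y, corr (cayleyEdge g) (fun _ => β) [y, u] = cayleySusceptibility g β := by
  simp only [corr_pair_comm (cayleyEdge g) _ _ u]
  simpa only [add_zero, id_eq, cayleyCorr, cayleySusceptibility] using sum_cayleyCorr g β id u 0

lemma sum_cayleyCorr_mul_le_cayleyBubble (u v a b : V) :
    ∑ x, cayleyCorr g β [u, x + a] * cayleyCorr g β [v, x + b] ≤ cayleyBubble g β :=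
  calc ∑ x, cayleyCorr g β [u, x + a] * cayleyCorr g β [v, x + b]
      ≤ ∑ x, (cayleyCorr g β [u, x + a] ^ 2 + cayleyCorr g β [v, x + b] ^ 2) / 2 :=
        sum_le_sum fun x _ => by
          linarith [two_mul_le_add_sq (cayleyCorr g β [u, x + a]) (cayleyCorr g β [v, x + b])]
    _ = cayleyBubble g β := by
        rw [← sum_div, sum_add_distrib, sum_cayleyCorr g β (· ^ 2), sum_cayleyCorr g β (· ^ 2),
          cayleyBubble, add_self_div_two]

lemma totalCov_cayleyEdge (x : V) (i : κ) :
    totalCov (cayleyEdge g) (fun _ => β) (x, i) = totalCov (cayleyEdge g) (fun _ => β) (0, i) := by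
  have htranslate := fun l => cayleyCorr_translate g β x l
  unfold totalCov
  rw [← Equiv.sum_comp (Equiv.addRight x)]
  refine sum_congr rfl fun y _ => ?_
  rw [← Equiv.sum_comp (Equiv.addRight x)]
  refine sum_congr rfl fun z _ => ?_
  have hfour := htranslate [y, z, 0, g i]
  have hpair := htranslate [y, z]
  have hedge := htranslate [0, g i]
  simp only [cayleyCorr, List.map_cons, List.map_nil, zero_add, add_comm (g i)] at hfour hpair hedge
  simp only [pairCov, cayleyEdge, Equiv.coe_addRight, hfour, hpair, hedge, zero_add]

theorem hasDerivAt_cayleySusceptibility :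
    HasDerivAt (cayleySusceptibility g) (∑ i, totalCov (cayleyEdge g) (fun _ => β) (0, i)) β := by
  have hcard : (Fintype.card V : ℝ) ≠ 0 := Nat.cast_ne_zero.2 Fintype.card_ne_zero
  have hderiv := (hasDerivAt_sum_corr (cayleyEdge g) (J := fun b _ => b) (J' := fun _ => 1)
    fun _ => hasDerivAt_id β).const_mul (Fintype.card V : ℝ)⁻¹
  simp only [fun b => sum_corr_right (cayleyEdge g) (sum_cayleyCorr_left g b),
    Fintype.sum_prod_type, totalCov_cayleyEdge, one_mul, sum_const, card_univ, nsmul_eq_mul,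
    inv_mul_cancel_left₀ hcard] at hderiv
  exact hderiv

lemma sum_cayleyCorr_foot_mul (f : κ → ℝ) :
    ∑ h, cayleyCorr g β [0, foot (cayleyEdge g) h] * f h.1.2 =
      2 * cayleySusceptibility g β * ∑ i, f i := by
  have hshift : ∀ a, ∑ x, cayleyCorr g β [0, x + a] = cayleySusceptibility g β :=
    fun a => sum_cayleyCorr g β id 0 a
  simp only [Fintype.sum_prod_type, foot_cayleyEdge, mul_sum]
  rw [sum_comm]
  refine sum_congr rfl fun i _ => ?_
  rw [sum_comm]
  simp only [← sum_mul, hshift, sum_const, card_univ, Fintype.card_bool]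
  ring

lemma sum_cayleyCorr_foot_mul_bondSum_le (u : V) (e : V × κ) :
    ∑ h, cayleyCorr g β [u, foot (cayleyEdge g) h] *
        bondSum (cayleyEdge g) (fun _ => β) e h.1 ≤
      8 * Fintype.card κ * cayleyBubble g β := by
  have hbond : ∀ i a, ∑ x, cayleyCorr g β [u, x + a] *
      bondSum (cayleyEdge g) (fun _ => β) e (x, i) ≤ 4 * cayleyBubble g β := fun i a => by
    have hle := fun v b => sum_cayleyCorr_mul_le_cayleyBubble g β u v a b
    have hfst := hle (cayleyEdge g e).1 0
    have hsnd := hle (cayleyEdge g e).2 0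
    simp only [add_zero] at hfst hsnd
    calc ∑ x, cayleyCorr g β [u, x + a] * bondSum (cayleyEdge g) (fun _ => β) e (x, i)
        = ∑ x, cayleyCorr g β [u, x + a] * cayleyCorr g β [(cayleyEdge g e).1, x] +
          ∑ x, cayleyCorr g β [u, x + a] * cayleyCorr g β [(cayleyEdge g e).1, x + g i] +
          (∑ x, cayleyCorr g β [u, x + a] * cayleyCorr g β [(cayleyEdge g e).2, x] +
          ∑ x, cayleyCorr g β [u, x + a] * cayleyCorr g β [(cayleyEdge g e).2, x + g i]) := by
          simp only [← sum_add_distrib, ← mul_add]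
          rfl
      _ ≤ 4 * cayleyBubble g β := by
          linarith [hle (cayleyEdge g e).1 (g i), hle (cayleyEdge g e).2 (g i)]
  simp only [Fintype.sum_prod_type, foot_cayleyEdge]
  rw [sum_comm]
  calc _ ≤ ∑ _ : κ, ∑ _ : Bool, 4 * cayleyBubble g β := sum_le_sum fun i _ => by
        rw [sum_comm]
        exact sum_le_sum fun b _ => hbond i _
    _ = _ := by
        simp only [sum_const, card_univ, Fintype.card_bool, nsmul_eq_mul]
        ring

variable {β} (hβ : 0 ≤ β)
include hβ

theorem sum_abs_ursell_cayleyEdge_ge {t : ℝ} (ht : t ∈ Set.Icc (0 : ℝ) 1) :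
    t * (β * cayleySusceptibility g β ^ 2 * deriv (cayleySusceptibility g) β) - t ^ 2 *
        (48 * Fintype.card κ ^ 2 * β ^ 2 * cayleySusceptibility g β ^ 4 * cayleyBubble g β) ≤
      (∑ x, ∑ y, ∑ z, |ursell (cayleyEdge g) (fun _ => β) 0 x y z|) / 2 := by
  have hχ := sum_cayleyCorr_left g β
  have hjoint := sum_jointWeight_ge (cayleyEdge g) (fun _ => hβ) hχ 0 ht
  have hfirst : ∑ h, corr (cayleyEdge g) (fun _ => β) [0, foot (cayleyEdge g) h] *
      (β * totalCov (cayleyEdge g) (fun _ => β) h.1) =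
      2 * cayleySusceptibility g β * (β * deriv (cayleySusceptibility g) β) := by
    rw [(hasDerivAt_cayleySusceptibility g β).deriv, mul_sum, ← sum_cayleyCorr_foot_mul]
    exact sum_congr rfl fun h _ => by rw [← totalCov_cayleyEdge g β h.1.1]; rfl
  have hsecond : ∑ h, corr (cayleyEdge g) (fun _ => β) [0, foot (cayleyEdge g) h] *
      ∑ h', corr (cayleyEdge g) (fun _ => β) [foot (cayleyEdge g) h, foot (cayleyEdge g) h'] *
        (β * β * bondSum (cayleyEdge g) (fun _ => β) h.1 h'.1) ≤
      2 * cayleySusceptibility g β * ∑ _ : κ, β ^ 2 * (8 * Fintype.card κ * cayleyBubble g β) := by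
    rw [← sum_cayleyCorr_foot_mul]
    refine sum_le_sum fun h _ => mul_le_mul_of_nonneg_left ?_ (corr_nonneg _ (fun _ => hβ) _)
    refine le_trans (le_of_eq ?_) (mul_le_mul_of_nonneg_left
      (sum_cayleyCorr_foot_mul_bondSum_le g β (foot (cayleyEdge g) h) h.1) (sq_nonneg β))
    rw [mul_sum, sq]
    exact sum_congr rfl fun h' _ => mul_left_comm _ _ _
  have hχ_nonneg : 0 ≤ cayleySusceptibility g β :=
    sum_nonneg fun x _ => corr_nonneg _ (fun _ => hβ) _
  have hsecond' := mul_le_mul_of_nonneg_left hsecond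
    (show 0 ≤ 3 * t ^ 2 * cayleySusceptibility g β ^ 3 by positivity)
  simp only [sum_const, card_univ, nsmul_eq_mul] at hsecond'
  simp only [abs_ursell _ fun _ => hβ, ← mul_sum]
  rw [hfirst] at hjoint
  linarith

end Cayley

lemma min_le_of_forall_sub_sq_le {a b S : ℝ} (ha : 0 ≤ a) (hb : 0 < b)
    (h : ∀ t ∈ Set.Icc (0 : ℝ) 1, t * a - t ^ 2 * b ≤ S) : min (a / 2) (a ^ 2 / (4 * b)) ≤ S := by
  rcases le_total a (2 * b) with hab | hab
  · have hopt := h (a / (2 * b)) ⟨by positivity, (div_le_one (by positivity)).2 hab⟩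
    have hvalue : a / (2 * b) * a - (a / (2 * b)) ^ 2 * b = a ^ 2 / (4 * b) := by
      field_simp
      ring
    exact (min_le_right _ _).trans (hvalue ▸ hopt)
  · have hend := h 1 (by simp)
    exact (min_le_left _ _).trans (by linarith)

section CayleySym2

variable {V : Type} {κ : Type*} [AddCommGroup V] {g : κ → V}

lemma cayleyEdge_sym2_injective (hg : Function.Injective g) (hne : ∀ i j, g i + g j ≠ 0) :
    Function.Injective fun q : V × κ => s((cayleyEdge g q).1, (cayleyEdge g q).2) := by
  rintro ⟨x, i⟩ ⟨y, j⟩ h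
  obtain ⟨rfl, h⟩ | ⟨rfl, h⟩ := Sym2.eq_iff.1 h
  · exact Prod.ext rfl (hg (add_left_cancel h))
  · exact absurd (add_eq_left.1 ((add_assoc y _ _).symm.trans h)) (hne j i)

end CayleySym2

section CayleyPos

variable {V : Type} {κ : Type*} [AddCommGroup V] [Fintype V] [DecidableEq V] [Fintype κ]
  (g : κ → V)

lemma cayleyBubble_pos (β : ℝ) : 0 < cayleyBubble g β :=
  sum_pos' (fun x _ => sq_nonneg _) ⟨0, mem_univ _, by simp [cayleyCorr]⟩

lemma cayleySusceptibility_pos {β : ℝ} (hβ : 0 ≤ β) : 0 < cayleySusceptibility g β :=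
  sum_pos' (fun x _ => corr_nonneg _ (fun _ => hβ) _) ⟨0, mem_univ _, by simp [cayleyCorr]⟩

lemma deriv_cayleySusceptibility_nonneg {β : ℝ} (hβ : 0 ≤ β) :
    0 ≤ deriv (cayleySusceptibility g) β := by
  rw [(hasDerivAt_cayleySusceptibility g β).deriv]
  exact sum_nonneg fun i _ => totalCov_nonneg _ (fun _ => hβ) _

end CayleyPos

end Ising

open Ising in
theorem proposition1p9_general {V : Type} {κ : Type*} [AddCommGroup V] [Fintype V] [DecidableEq V]
    [Fintype κ] [Nonempty κ] (g : κ → V) {β : ℝ} (hβ : 0 < β) :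
    DifferentiableAt ℝ (cayleySusceptibility g) β ∧
    1 / (128 * (Fintype.card κ : ℝ) ^ 2) *
        min (β * cayleySusceptibility g β ^ 2 * deriv (cayleySusceptibility g) β)
          (1 / cayleyBubble g β * deriv (cayleySusceptibility g) β ^ 2) ≤
      ∑ x, ∑ y, ∑ z, |ursell (cayleyEdge g) (fun _ => β) 0 x y z| := by
  refine ⟨(hasDerivAt_cayleySusceptibility g β).differentiableAt, ?_⟩
  have hχ := cayleySusceptibility_pos g hβ.le
  have hD := deriv_cayleySusceptibility_nonneg g hβ.le
  have hB := cayleyBubble_pos g β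
  have hκ : (1 : ℝ) ≤ (Fintype.card κ : ℝ) ^ 2 :=
    one_le_pow₀ (Nat.one_le_cast.2 Fintype.card_pos)
  have hmin := min_le_of_forall_sub_sq_le (by positivity) (by positivity)
    fun t ht => sum_abs_ursell_cayleyEdge_ge g hβ.le ht
  rw [le_div_iff₀ two_pos, min_mul_of_nonneg _ _ zero_le_two] at hmin
  refine le_trans ?_ hmin
  rw [mul_min_of_nonneg _ _ (by positivity)]
  set χ := cayleySusceptibility g β
  set D := deriv (cayleySusceptibility g) β
  set B := cayleyBubble g β
  set n : ℝ := (Fintype.card κ : ℝ)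
  refine min_le_min ?_ ?_
  · rw [div_mul_cancel₀ _ two_ne_zero]
    refine mul_le_of_le_one_left (by positivity) ((div_le_one (by positivity)).2 (by linarith))
  · calc 1 / (128 * n ^ 2) * (1 / B * D ^ 2)
        ≤ 1 / (96 * n ^ 2) * (1 / B * D ^ 2) := by gcongr; norm_num
      _ = _ := by
        field_simp
        ring

namespace TorusIsing

open Ising

variable (d r : ℕ)

/-- The coordinate unit vectors, which generate the torus. -/
def unitVec (i : Fin d) : Torus d r := Pi.single i 1

variable {d r} (hr : 3 ≤ r)
include hr

lemma one_ne_zero_zmod : (1 : ZMod r) ≠ 0 := by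
  have : Fact (1 < r) := ⟨by omega⟩
  exact one_ne_zero

lemma one_add_one_ne_zero_zmod : (1 : ZMod r) + 1 ≠ 0 := by
  rw [one_add_one_eq_two, ← Nat.cast_two, Ne, ZMod.natCast_eq_zero_iff]
  exact Nat.not_dvd_of_pos_of_lt two_pos hr

lemma unitVec_injective : Function.Injective (unitVec d r) := fun i j hij => by
  by_contra hne
  exact one_ne_zero_zmod hr (by simpa [unitVec, hne] using congrFun hij i)

lemma unitVec_add_unitVec_ne_zero (i j : Fin d) : unitVec d r i + unitVec d r j ≠ 0 := fun h => by
  have hi := congrFun h i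
  obtain rfl | hij := eq_or_ne i j
  · exact one_add_one_ne_zero_zmod hr (by simpa [unitVec] using hi)
  · exact one_ne_zero_zmod hr (by simpa [unitVec, hij] using hi)

lemma torusGraph_edgeFinset [NeZero r] : (torusGraph d r).edgeFinset =
    univ.image fun q => s((cayleyEdge (unitVec d r) q).1, (cayleyEdge (unitVec d r) q).2) := by
  have hunit : ∀ i, unitVec d r i ≠ 0 := fun i => Pi.single_ne_zero_iff.2 (one_ne_zero_zmod hr)
  ext e
  induction e using Sym2.ind with
  | _ x y =>
    rw [SimpleGraph.mem_edgeFinset, SimpleGraph.mem_edgeSet, torusGraph, SimpleGraph.fromRel_adj]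
    simp only [mem_image, mem_univ, true_and, Prod.exists, cayleyEdge, Sym2.eq_iff]
    constructor
    · rintro ⟨-, ⟨i, rfl⟩ | ⟨i, rfl⟩⟩
      · exact ⟨x, i, .inl ⟨rfl, rfl⟩⟩
      · exact ⟨y, i, .inr ⟨rfl, rfl⟩⟩
    · rintro ⟨u, i, ⟨rfl, rfl⟩ | ⟨rfl, rfl⟩⟩
      · exact ⟨(add_ne_left.2 (hunit i)).symm, .inl ⟨i, rfl⟩⟩
      · exact ⟨add_ne_left.2 (hunit i), .inr ⟨i, rfl⟩⟩

variable [NeZero r] (β : ℝ)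

lemma hamiltonian_torusGraph (σ : SpinConfig (Torus d r)) :
    hamiltonian (torusGraph d r) σ = -∑ q, bond (cayleyEdge (unitVec d r)) q σ := by
  have hinj := cayleyEdge_sym2_injective (unitVec_injective (d := d) hr)
    (unitVec_add_unitVec_ne_zero hr)
  rw [hamiltonian, torusGraph_edgeFinset hr, sum_image hinj.injOn]
  rfl

lemma expectation_torusGraph (l : List (Torus d r)) :
    expectation (torusGraph d r) β (spinProd l) = cayleyCorr (unitVec d r) β l := by
  have hweight : ∀ σ : SpinConfig (Torus d r), Real.exp (-β * hamiltonian (torusGraph d r) σ) =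
      weight (cayleyEdge (unitVec d r)) (fun _ => β) σ := fun σ => by
    rw [hamiltonian_torusGraph hr, weight, ← mul_sum, neg_mul_neg]
  simp only [expectation, partitionFunction, hweight, cayleyCorr, corr, weightSum]
  ring

lemma twoPoint_eq_cayleyCorr (x y : Torus d r) :
    twoPoint d r β x y = cayleyCorr (unitVec d r) β [x, y] := by
  rw [← expectation_torusGraph hr, twoPoint]
  exact congrArg _ (funext fun σ => by simp)

lemma fourPoint_eq_cayleyCorr (w x y z : Torus d r) :
    fourPoint d r β w x y z = cayleyCorr (unitVec d r) β [w, x, y, z] := by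
  rw [← expectation_torusGraph hr, fourPoint]
  exact congrArg _ (funext fun σ => by simp [mul_assoc])

lemma susceptibility_eq_cayleySusceptibility :
    susceptibility d r β = cayleySusceptibility (unitVec d r) β :=
  sum_congr rfl fun x _ => twoPoint_eq_cayleyCorr hr β 0 x

lemma bubble_eq_cayleyBubble : bubble d r β = cayleyBubble (unitVec d r) β :=
  sum_congr rfl fun x _ => congrArg (· ^ 2) (twoPoint_eq_cayleyCorr hr β 0 x)

lemma ursell4_eq_ursell (w x y z : Torus d r) :
    ursell4 d r β w x y z = ursell (cayleyEdge (unitVec d r)) (fun _ => β) w x y z := by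
  simp only [ursell4, ursell, twoPoint_eq_cayleyCorr hr, fourPoint_eq_cayleyCorr hr, cayleyCorr]

end TorusIsing

theorem proposition1p9 (d r : ℕ) [NeZero r] (hd : 1 ≤ d) (hr : 3 ≤ r) (β : ℝ) (hβ : 0 < β) :
    DifferentiableAt ℝ (fun b : ℝ => TorusIsing.susceptibility d r b) β ∧
    (1 / (128 * (d : ℝ) ^ 2)) *
        min (β * TorusIsing.susceptibility d r β ^ 2 *
              deriv (fun b : ℝ => TorusIsing.susceptibility d r b) β)
            ((1 / TorusIsing.bubble d r β) *
              (deriv (fun b : ℝ => TorusIsing.susceptibility d r b) β) ^ 2)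
      ≤ ∑ x : Torus d r, ∑ y : Torus d r, ∑ z : Torus d r,
          |TorusIsing.ursell4 d r β 0 x y z| := by
  have : Nonempty (Fin d) := ⟨⟨0, hd⟩⟩
  simp only [TorusIsing.susceptibility_eq_cayleySusceptibility hr,
    TorusIsing.bubble_eq_cayleyBubble hr, TorusIsing.ursell4_eq_ursell hr]
  simpa only [Fintype.card_fin] using proposition1p9_general (TorusIsing.unitVec d r) hβ
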